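/- Let $\mathbb{D}\subset\mathbb{C}$ be the open unit disk. Let $\Phi\colon[0,\infty)\to[0,\infty)$ be an $N$-function, that is, $\Phi$ is continuous, convex and increasing, $\Phi(0)=0$, $\lim_{t\to0^+}\Phi(t)/t=0$ and $\lim_{t\to\infty}\Phi(t)/t=\infty$. Suppose that $\Phi$ is doubling, that is, there is a constant $C\ge 2$ with $\Phi(2t)\le C\,\Phi(t)$ for all $t\ge0$, and that $$\int_1^\infty\frac{\Phi(t)}{t^3}\,dt<\infty .$$ Then every homeomorphism $\varphi$ of the unit circle $\partial\mathbb{D}$ onto itself satisfies the $\Phi$-Douglas condition $$\int_{\partial\mathbb{D}}\int_{\partial\mathbb{D}}\Phi\left(\left|\frac{\varphi(\xi)-\varphi(\eta)}{\xi-\eta}\right|\right)|d\xi|\,|d\eta|<\infty ,$$ and $\varphi$ admits a homeomorphic extension $h\colon\overline{\mathbb{D}}\to\overline{\mathbb{D}}$ (a homeomorphism of the closed disk onto itself with $h=\varphi$ on $\partial\mathbb{D}$) such that both $h$ and $h^{-1}$ belong to the Orlicz--Sobolev space $$W^{1,\Phi}(\mathbb{D},\mathbb{C})=\left\{f\in W^{1,1}(\mathbb{D},\mathbb{C})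 : \int_{\mathbb{D}}\Phi(|Df(x)|)\,dx<\infty\right\},$$ where $Df$ is the weak differential of $f$ and $|Df|$ its operator norm. -/

import Mathlib

open MeasureTheory Set Filter Topology
open scoped ContDiff

noncomputable section

namespace OrliczDisk

/-- `Φ` is an `N`-function on `[0, ∞)`; only the values of `Φ` on `[0, ∞)` matter. -/
structure IsNFunction (Φ : ℝ → ℝ) : Prop where
  continuousOn : ContinuousOn Φ (Ici 0)
  convexOn : ConvexOn ℝ (Ici 0) Φ
  monotoneOn : MonotoneOn Φ (Ici 0)
  map_zero : Φ 0 = 0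
  tendsto_zero : Tendsto (fun t => Φ t / t) (𝓝[>] 0) (𝓝 0)
  tendsto_atTop : Tendsto (fun t => Φ t / t) atTop atTop

/-- The doubling (`Δ₂`) condition. -/
def IsDoubling (Φ : ℝ → ℝ) : Prop :=
  ∃ C : ℝ, 2 ≤ C ∧ ∀ t : ℝ, 0 ≤ t → Φ (2 * t) ≤ C * Φ t

/-- The open unit disk. -/
abbrev disk : Set ℂ := Metric.ball 0 1

/-- The closed unit disk. -/
abbrev closedDisk : Set ℂ := Metric.closedBall 0 1

/-- The unit circle, the boundary of the unit disk. -/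
abbrev circle : Set ℂ := Metric.sphere 0 1

/-- Arc length `|dξ|` on the unit circle (total mass `2π`): the image of Lebesgue measure on
`(-π, π]` under `θ ↦ exp (i θ)`. -/
def arcLength : Measure circle :=
  (volume.restrict (Ioc (-Real.pi) Real.pi)).map
    (fun θ : ℝ => (⟨circleMap 0 1 θ, circleMap_mem_sphere 0 zero_le_one θ⟩ : circle))

/-- The `Φ`-Douglas condition for a map of the unit circle. The diagonal `ξ = η` is a null set, so
the value of the quotient there is immaterial. -/
def Douglas (Φ : ℝ → ℝ) (φ : circle → ℂ) : Prop :=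
  ∫⁻ ξ : circle, ∫⁻ η : circle,
    ENNReal.ofReal (Φ ‖(φ ξ - φ η) / ((ξ : ℂ) - (η : ℂ))‖) ∂arcLength ∂arcLength < ⊤

/-- `G` is the weak differential of `f` on the open set `Ω`: for every real test function
`u ∈ C_c^∞(Ω)` and every direction `v`, `∫_Ω (∂_v u) f = - ∫_Ω u (G v)`.
(Used only for `f` and `G` integrable on `Ω`.) -/
def IsWeakDifferential (Ω : Set ℂ) (f : ℂ → ℂ) (G : ℂ → ℂ →L[ℝ] ℂ) : Prop :=
  ∀ u : ℂ → ℝ, ContDiff ℝ ∞ u → HasCompactSupport u → tsupport u ⊆ Ω → ∀ v : ℂ,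
    ∫ z in Ω, (fderiv ℝ u z v) • f z = - ∫ z in Ω, u z • G z v

/-- `f ∈ W^{1,Φ}(Ω, ℂ)`: the function `f` belongs to `W^{1,1}(Ω, ℂ)`, with weak differential
`Df = G`, and `∫_Ω Φ(|Df|) < ∞`, where `|Df|` is the operator norm. -/
def MemOrliczSobolev (Φ : ℝ → ℝ) (Ω : Set ℂ) (f : ℂ → ℂ) : Prop :=
  IntegrableOn f Ω ∧ ∃ G : ℂ → ℂ →L[ℝ] ℂ, IntegrableOn G Ω ∧ IsWeakDifferential Ω f G ∧
    ∫⁻ z in Ω, ENNReal.ofReal (Φ ‖G z‖) < ⊤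

/-- A self-map of the closed unit disk as a function on the plane, extended by zero outside (the
values outside the disk play no role). -/
def toPlane (h : closedDisk → closedDisk) : ℂ → ℂ :=
  Function.extend (fun z : closedDisk => (z : ℂ)) (fun z => (h z : ℂ)) 0

/-- `h` extends the circle map `φ` to the closed unit disk. -/
def IsExtension (φ : circle → circle) (h : closedDisk → closedDisk) : Prop :=
  ∀ ξ : circle, (h (inclusion Metric.sphere_subset_closedBall ξ) : ℂ) = (φ ξ : ℂ)

end OrliczDisk

end

namespace OrliczDisk

/-! After a conjugation if necessary, `φ` preserves orientation and lifts to an increasing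
homeomorphism `g` of the line with `g (x + 2π) = g x + 2π`; let `k` be its inverse. Put `P = expand
g` and `R = expand k`. Each is `2z` plus the gradient of a convex function, hence a strongly
monotone map of the plane: it expands distances by a factor at least 2 (`two_mul_norm_sub_le`) and
is onto, because a coercive convex function attains its minimum (`surjective_expand`). On the real
line `P x = 2x + 2 g x = R (g x)`, so `H = R⁻¹ ∘ P` is a homeomorphism of the plane extending `g`.
It preserves the upper half-plane and commutes with translation by `2π`, so it descends through `z ↦
exp (i z)` to a homeomorphism of the closed disk extending `φ`. The inverse `P⁻¹ ∘ R` is the same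
construction with `g` and `k` exchanged, so one estimate serves both `h` and `h⁻¹`.

Since `R⁻¹` is a contraction, `H` inherits the local Lipschitz constant of `P`, which at height `y`
is at most a constant plus a multiple of `(g (x + 2y) - g (x - 2y)) / y` (`norm_expand_sub_le`).
Near the boundary this is `O(1/y)` pointwise, and its mean over a period is bounded independently of
`y`, because `g x - x` is periodic. Convexity gives `Φ t ≤ (t/m) Φ m` for `t ≤ m`; with `m = B/s`
the energy of the slice at distance `s` from the circle is `O(s Φ(B/s))`. The substitution `t = B/s`
turns the integral over `s` into that of `Φ t / t^3` (`lintegral_lintegral_lt_top`). The Douglas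
integral is treated identically, `s` now being the angular distance between the two points. -/

/-- A continuous nondecreasing lift to the real line of a degree-one self-map of the circle. -/
structure IsCircleLift (g : ℝ → ℝ) : Prop where
  continuous : Continuous g
  monotone : Monotone g
  map_add : ∀ x, g (x + 2 * Real.pi) = g x + 2 * Real.pi

/-- The map `z ↦ 2 z + ∫_{-1}^1 g (x + y s) (1 + i s) ds`, with `z = x + i y`: twice the identity
plus a Beurling-Ahlfors extension of `g`. -/
noncomputable def expand (g : ℝ → ℝ) (z : ℂ) : ℂ :=
  ⟨2 * z.re + ∫ s in (-1 : ℝ)..1, g (z.re + z.im * s),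
    2 * z.im + ∫ s in (-1 : ℝ)..1, g (z.re + z.im * s) * s⟩

/-! ### Strong monotonicity and local Lipschitz bounds for the expanding map -/

section Expand

variable {g k : ℝ → ℝ}

theorem intervalIntegrable_comp_line (hg : Continuous g) (x y a b : ℝ) :
    IntervalIntegrable (fun s => g (x + y * s)) volume a b :=
  Continuous.intervalIntegrable (by fun_prop) _ _

theorem intervalIntegrable_comp_line_mul (hg : Continuous g) (x y a b : ℝ) :
    IntervalIntegrable (fun s => g (x + y * s) * s) volume a b :=
  Continuous.intervalIntegrable (by fun_prop) _ _

theorem integral_const_mul_self (c : ℝ) : ∫ s in (-1 : ℝ)..1, c * s = 0 := by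
  rw [intervalIntegral.integral_const_mul, integral_id]
  norm_num

theorem continuous_expand (hg : Continuous g) : Continuous (expand g) := by
  have h1 : Continuous fun z : ℂ => ∫ s in (-1 : ℝ)..1, g (z.re + z.im * s) :=
    intervalIntegral.continuous_parametric_intervalIntegral_of_continuous' (by fun_prop) _ _
  have h2 : Continuous fun z : ℂ => ∫ s in (-1 : ℝ)..1, g (z.re + z.im * s) * s :=
    intervalIntegral.continuous_parametric_intervalIntegral_of_continuous' (by fun_prop) _ _
  have : expand g = fun z : ℂ =>
      ((2 * z.re + ∫ s in (-1 : ℝ)..1, g (z.re + z.im * s) : ℝ) : ℂ) +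
      ((2 * z.im + ∫ s in (-1 : ℝ)..1, g (z.re + z.im * s) * s : ℝ) : ℂ) * Complex.I := by
    funext z
    apply Complex.ext <;> simp [expand]
  rw [this]
  fun_prop

/-- Strong monotonicity of `expand g` as an operator on the plane. -/
theorem two_mul_normSq_le (hg : Continuous g) (hm : Monotone g) (z w : ℂ) :
    2 * ((z - w).re ^ 2 + (z - w).im ^ 2) ≤
      (expand g z - expand g w).re * (z - w).re + (expand g z - expand g w).im * (z - w).im := by
  -- Pairing the integral part with `z - w` gives the integrand `(g a - g b) (a - b)`, nonnegative
  -- by monotonicity; the summand `2z` contributes the left-hand side.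
  have hI : 0 ≤ ∫ s in (-1 : ℝ)..1, (g (z.re + z.im * s) - g (w.re + w.im * s)) *
      ((z.re + z.im * s) - (w.re + w.im * s)) := by
    apply intervalIntegral.integral_nonneg (by norm_num)
    intro s _
    rcases le_total (z.re + z.im * s) (w.re + w.im * s) with h | h
    · exact mul_nonneg_of_nonpos_of_nonpos (by linarith [hm h]) (by linarith)
    · exact mul_nonneg (by linarith [hm h]) (by linarith)
  have i1 := intervalIntegrable_comp_line hg z.re z.im (-1) 1
  have i2 := intervalIntegrable_comp_line hg w.re w.im (-1) 1
  have i3 := intervalIntegrable_comp_line_mul hg z.re z.im (-1) 1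
  have i4 := intervalIntegrable_comp_line_mul hg w.re w.im (-1) 1
  have hE : (∫ s in (-1 : ℝ)..1, (g (z.re + z.im * s) - g (w.re + w.im * s)) *
      ((z.re + z.im * s) - (w.re + w.im * s))) =
      ((∫ s in (-1 : ℝ)..1, g (z.re + z.im * s)) - ∫ s in (-1 : ℝ)..1, g (w.re + w.im * s)) *
        (z.re - w.re) +
      ((∫ s in (-1 : ℝ)..1, g (z.re + z.im * s) * s) -
        ∫ s in (-1 : ℝ)..1, g (w.re + w.im * s) * s) * (z.im - w.im) := by
    rw [← intervalIntegral.integral_sub i1 i2, ← intervalIntegral.integral_sub i3 i4,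
      ← intervalIntegral.integral_mul_const, ← intervalIntegral.integral_mul_const,
      ← intervalIntegral.integral_add ((i1.sub i2).mul_const _) ((i3.sub i4).mul_const _)]
    congr 1
    funext s
    ring
  rw [hE] at hI
  simp only [expand, Complex.sub_re, Complex.sub_im]
  nlinarith [hI]

theorem two_mul_norm_sub_le (hg : Continuous g) (hm : Monotone g) (z w : ℂ) :
    2 * ‖z - w‖ ≤ ‖expand g z - expand g w‖ := by
  have h := two_mul_normSq_le hg hm z w
  rcases eq_or_lt_of_le (norm_nonneg (z - w)) with h0 | h0
  · rw [← h0]; simp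
  set a := z - w
  set b := expand g z - expand g w
  have ha : ‖a‖ ^ 2 = a.re ^ 2 + a.im ^ 2 := by
    rw [← Complex.normSq_eq_norm_sq, Complex.normSq_apply]; ring
  have hb : ‖b‖ ^ 2 = b.re ^ 2 + b.im ^ 2 := by
    rw [← Complex.normSq_eq_norm_sq, Complex.normSq_apply]; ring
  have hcs : b.re * a.re + b.im * a.im ≤ ‖b‖ * ‖a‖ := by
    refine abs_le_of_sq_le_sq' ?_ (by positivity) |>.2
    rw [mul_pow, ha, hb]
    nlinarith [sq_nonneg (b.re * a.im - b.im * a.re)]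
  have : 2 * ‖a‖ * ‖a‖ ≤ ‖b‖ * ‖a‖ := by nlinarith
  exact le_of_mul_le_mul_right this h0

theorem expand_ofReal (x : ℝ) : expand g x = ((2 * x + 2 * g x : ℝ) : ℂ) := by
  apply Complex.ext
  · simp only [expand, Complex.ofReal_re, Complex.ofReal_im, zero_mul, add_zero,
      intervalIntegral.integral_const, smul_eq_mul]
    ring
  · simp [expand, integral_const_mul_self]

/-- Strong monotonicity applied to `z` and its real part, since the real line is mapped to itself.
It shows that the sign of the imaginary part is preserved. -/
theorem two_mul_im_sq_le (hg : Continuous g) (hm : Monotone g) (z : ℂ) :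
    2 * z.im ^ 2 ≤ (expand g z).im * z.im := by
  have h := two_mul_normSq_le hg hm z (z.re : ℂ)
  rw [expand_ofReal] at h
  simpa using h

theorem norm_expand_sub_expand_le {C : ℝ} (hg : Continuous g) (hk : Continuous k)
    (hC : ∀ x, |g x - k x| ≤ C) (z : ℂ) : ‖expand g z - expand k z‖ ≤ 4 * C := by
  have i1 := intervalIntegrable_comp_line hg z.re z.im (-1) 1
  have i2 := intervalIntegrable_comp_line hk z.re z.im (-1) 1
  have i3 := intervalIntegrable_comp_line_mul hg z.re z.im (-1) 1
  have i4 := intervalIntegrable_comp_line_mul hk z.re z.im (-1) 1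
  have hC0 : 0 ≤ C := (abs_nonneg _).trans (hC 0)
  refine (Complex.norm_le_abs_re_add_abs_im _).trans ?_
  have e1 : (expand g z - expand k z).re =
      ∫ s in (-1 : ℝ)..1, (g (z.re + z.im * s) - k (z.re + z.im * s)) := by
    rw [intervalIntegral.integral_sub i1 i2]; simp [expand]
  have e2 : (expand g z - expand k z).im =
      ∫ s in (-1 : ℝ)..1, (g (z.re + z.im * s) * s - k (z.re + z.im * s) * s) := by
    rw [intervalIntegral.integral_sub i3 i4]; simp [expand]
  have b1 : |(expand g z - expand k z).re| ≤ C * |1 - (-1)| := by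
    rw [e1, ← Real.norm_eq_abs]
    exact intervalIntegral.norm_integral_le_of_norm_le_const fun s _ => by
      rw [Real.norm_eq_abs]; exact hC _
  have b2 : |(expand g z - expand k z).im| ≤ C * |1 - (-1)| := by
    rw [e2, ← Real.norm_eq_abs]
    refine intervalIntegral.norm_integral_le_of_norm_le_const fun s hs => ?_
    rw [uIoc_of_le (by norm_num)] at hs
    rw [← sub_mul, norm_mul]
    have : ‖s‖ ≤ 1 := abs_le.2 ⟨hs.1.le, hs.2⟩
    calc _ ≤ C * 1 := mul_le_mul (hC _) this (norm_nonneg _) hC0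
      _ = C := mul_one C
  have h2 : |(1 : ℝ) - (-1)| = 2 := by norm_num
  rw [h2] at b1 b2
  linarith

theorem expand_add_period (hg : IsCircleLift g) (z : ℂ) :
    expand g (z + ((2 * Real.pi : ℝ) : ℂ)) = expand g z + ((8 * Real.pi : ℝ) : ℂ) := by
  have i1 := intervalIntegrable_comp_line hg.continuous z.re z.im (-1) 1
  have i3 := intervalIntegrable_comp_line_mul hg.continuous z.re z.im (-1) 1
  have e (s : ℝ) : g (z.re + 2 * Real.pi + z.im * s) = g (z.re + z.im * s) + 2 * Real.pi := by
    rw [← hg.map_add]; ring_nf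
  apply Complex.ext
  · simp only [expand, Complex.add_re, Complex.add_im, Complex.ofReal_re, Complex.ofReal_im,
      add_zero, e]
    rw [intervalIntegral.integral_add i1 intervalIntegrable_const]
    simp
    ring
  · simp only [expand, Complex.add_re, Complex.add_im, Complex.ofReal_re, Complex.ofReal_im,
      add_zero, e, add_mul]
    rw [intervalIntegral.integral_add i3 (Continuous.intervalIntegrable (by fun_prop) _ _)]
    simp [integral_const_mul_self]

/-- The common part of the two intervals cancels, leaving an interval of length `2c` around each
endpoint, where monotonicity bounds `g`. -/
theorem integral_shift_sub_le (hg : Continuous g) (hm : Monotone g) {a b c : ℝ} (hc : 0 ≤ c) :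
    (∫ t in (a + c)..(b + c), g t) - ∫ t in (a - c)..(b - c), g t ≤
      2 * c * (g (b + c) - g (a - c)) := by
  have i (u v : ℝ) : IntervalIntegrable g volume u v := hg.intervalIntegrable _ _
  have e : (∫ t in (a + c)..(b + c), g t) - ∫ t in (a - c)..(b - c), g t =
      (∫ t in (b - c)..(b + c), g t) - ∫ t in (a - c)..(a + c), g t := by
    have h1 := intervalIntegral.integral_add_adjacent_intervals (i (a - c) (a + c)) (i (a + c) (b + c))
    have h2 := intervalIntegral.integral_add_adjacent_intervals (i (a - c) (b - c)) (i (b - c) (b + c))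
    linarith
  have h1 : (∫ t in (b - c)..(b + c), g t) ≤ ∫ t in (b - c)..(b + c), g (b + c) :=
    intervalIntegral.integral_mono_on (by linarith) (i _ _) (by simp) fun t ht => hm ht.2
  have h2 : (∫ t in (a - c)..(a + c), g (a - c)) ≤ ∫ t in (a - c)..(a + c), g t :=
    intervalIntegral.integral_mono_on (by linarith) (by simp) (i _ _) fun t ht => hm ht.1
  rw [e]
  simp only [intervalIntegral.integral_const, smul_eq_mul] at h1 h2
  linarith

/-- Local Lipschitz bound for `expand g` in the upper half-plane. -/
theorem norm_expand_sub_le (hg : Continuous g) (hm : Monotone g) {z w : ℂ} (hz : 0 < z.im)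
    (hw : ‖w - z‖ ≤ z.im / 2) :
    ‖expand g w - expand g z‖ ≤
      (2 + 8 * ((g (z.re + 2 * z.im) - g (z.re - 2 * z.im)) / z.im)) * ‖w - z‖ := by
  set δ := ‖w - z‖ with hδ
  set x := z.re
  set y := z.im
  have hδ0 : 0 ≤ δ := norm_nonneg _
  have hre : |w.re - x| ≤ δ := by simpa using Complex.abs_re_le_norm (w - z)
  have him : |w.im - y| ≤ δ := by simpa using Complex.abs_im_le_norm (w - z)
  have i1 := intervalIntegrable_comp_line hg x y (-1) 1
  have i2 := intervalIntegrable_comp_line hg w.re w.im (-1) 1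
  have i3 := intervalIntegrable_comp_line_mul hg x y (-1) 1
  have i4 := intervalIntegrable_comp_line_mul hg w.re w.im (-1) 1
  -- Each argument moves by at most `2δ`, so monotonicity replaces differentiability of `g`;
  -- integration over `s` then recovers a factor `δ`.
  have hpt : ∀ s ∈ Ioc (-1 : ℝ) 1, |g (w.re + w.im * s) - g (x + y * s)| ≤
      g (x + 2 * δ + y * s) - g (x - 2 * δ + y * s) := by
    intro s hs
    have hs1 : |s| ≤ 1 := abs_le.2 ⟨hs.1.le, hs.2⟩
    have hd : |(w.re + w.im * s) - (x + y * s)| ≤ 2 * δ := by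
      have : (w.re + w.im * s) - (x + y * s) = (w.re - x) + (w.im - y) * s := by ring
      rw [this]
      refine (abs_add_le _ _).trans ?_
      rw [abs_mul]
      nlinarith [abs_nonneg (w.im - y), abs_nonneg s]
    rw [abs_le] at hd ⊢
    constructor
    · have h1 := hm (show x - 2 * δ + y * s ≤ w.re + w.im * s by linarith)
      have h2 := hm (show x + y * s ≤ x + 2 * δ + y * s by linarith)
      linarith
    · have h1 := hm (show w.re + w.im * s ≤ x + 2 * δ + y * s by linarith)
      have h2 := hm (show x - 2 * δ + y * s ≤ x + y * s by linarith)
      linarith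
  set J := ∫ s in (-1 : ℝ)..1, (g (x + 2 * δ + y * s) - g (x - 2 * δ + y * s)) with hJ
  have hJi : IntervalIntegrable (fun s => g (x + 2 * δ + y * s) - g (x - 2 * δ + y * s))
      volume (-1) 1 := Continuous.intervalIntegrable (by fun_prop) _ _
  have hJle : J ≤ 4 * ((g (x + 2 * y) - g (x - 2 * y)) / y) * δ := by
    rw [hJ, intervalIntegral.integral_sub (intervalIntegrable_comp_line hg _ _ _ _)
      (intervalIntegrable_comp_line hg _ _ _ _),
      intervalIntegral.integral_comp_add_mul (fun t => g t) hz.ne',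
      intervalIntegral.integral_comp_add_mul (fun t => g t) hz.ne', ← smul_sub, smul_eq_mul]
    have h := integral_shift_sub_le hg hm (a := x - y) (b := x + y) (c := 2 * δ) (by linarith)
    have h1 := hm (show x + y + 2 * δ ≤ x + 2 * y by linarith)
    have h2 := hm (show x - 2 * y ≤ x - y - 2 * δ by linarith)
    have e1 : x + 2 * δ + y * -1 = x - y + 2 * δ := by ring
    have e2 : x + 2 * δ + y * 1 = x + y + 2 * δ := by ring
    have e3 : x - 2 * δ + y * -1 = x - y - 2 * δ := by ring
    have e4 : x - 2 * δ + y * 1 = x + y - 2 * δ := by ring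
    rw [e1, e2, e3, e4]
    calc _ ≤ y⁻¹ * (2 * (2 * δ) * (g (x + y + 2 * δ) - g (x - y - 2 * δ))) := by gcongr
      _ ≤ y⁻¹ * (2 * (2 * δ) * (g (x + 2 * y) - g (x - 2 * y))) := by gcongr
      _ = _ := by field_simp; ring
  have b1 : |∫ s in (-1 : ℝ)..1, (g (w.re + w.im * s) - g (x + y * s))| ≤ J := by
    rw [← Real.norm_eq_abs]
    exact intervalIntegral.norm_integral_le_of_norm_le (by norm_num) (Eventually.of_forall hpt) hJi
  have b2 : |∫ s in (-1 : ℝ)..1, (g (w.re + w.im * s) * s - g (x + y * s) * s)| ≤ J := by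
    rw [← Real.norm_eq_abs]
    refine intervalIntegral.norm_integral_le_of_norm_le (by norm_num)
      (Eventually.of_forall fun s hs => ?_) hJi
    rw [← sub_mul, norm_mul]
    have hs1 : ‖s‖ ≤ 1 := abs_le.2 ⟨hs.1.le, hs.2⟩
    exact (mul_le_of_le_one_right (norm_nonneg _) hs1).trans (hpt s hs)
  have e : expand g w - expand g z = 2 * (w - z) +
      ⟨∫ s in (-1 : ℝ)..1, (g (w.re + w.im * s) - g (x + y * s)),
        ∫ s in (-1 : ℝ)..1, (g (w.re + w.im * s) * s - g (x + y * s) * s)⟩ := by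
    rw [intervalIntegral.integral_sub i2 i1, intervalIntegral.integral_sub i4 i3]
    apply Complex.ext <;> simp [expand, x, y] <;> ring
  rw [e]
  refine (norm_add_le _ _).trans ?_
  have h2 : ‖(2 : ℂ) * (w - z)‖ = 2 * δ := by rw [norm_mul]; simp [hδ]
  rw [h2]
  have h3 := Complex.norm_le_abs_re_add_abs_im
    (⟨∫ s in (-1 : ℝ)..1, (g (w.re + w.im * s) - g (x + y * s)),
        ∫ s in (-1 : ℝ)..1, (g (w.re + w.im * s) * s - g (x + y * s) * s)⟩ : ℂ)
  simp only at h3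
  linarith

end Expand

/-! ### Surjectivity by minimizing a convex functional -/

section Surjective

variable {g : ℝ → ℝ}

/-- The convex potential of the integral part of `expand g`. -/
noncomputable def potential (g : ℝ → ℝ) (z : ℂ) : ℝ :=
  ∫ s in (-1 : ℝ)..1, ∫ t in (0 : ℝ)..(z.re + z.im * s), g t

theorem continuous_potential (hg : Continuous g) : Continuous (potential g) := by
  have hG : Continuous fun b : ℝ => ∫ t in (0 : ℝ)..b, g t :=
    intervalIntegral.continuous_primitive (fun _ _ => hg.intervalIntegrable _ _) 0
  exact intervalIntegral.continuous_parametric_intervalIntegral_of_continuous'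
    (f := fun (z : ℂ) (s : ℝ) => ∫ t in (0 : ℝ)..(z.re + z.im * s), g t)
    (hG.comp (by fun_prop : Continuous fun p : ℂ × ℝ => p.1.re + p.1.im * p.2)) _ _

theorem mul_sub_le_integral (hg : Continuous g) (hm : Monotone g) (a b : ℝ) :
    g a * (b - a) ≤ ∫ t in a..b, g t := by
  rcases le_total a b with h | h
  · have := intervalIntegral.integral_mono_on (μ := volume) h (by simp) (hg.intervalIntegrable a b)
      (f := fun _ => g a) fun t ht => hm ht.1
    simp at this
    linarith
  · have := intervalIntegral.integral_mono_on (μ := volume) h (hg.intervalIntegrable b a) (by simp)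
      (g := fun _ => g a) fun t ht => hm ht.2
    rw [intervalIntegral.integral_symm]
    simp at this
    linarith

/-- A primitive of the monotone `g` has `g` as a subgradient; the inequality is integrated over `s`.
-/
theorem potential_subgradient (hg : Continuous g) (hm : Monotone g) (z w : ℂ) :
    ((expand g z).re - 2 * z.re) * (w.re - z.re) + ((expand g z).im - 2 * z.im) * (w.im - z.im) ≤
      potential g w - potential g z := by
  have hG : Continuous fun b : ℝ => ∫ t in (0 : ℝ)..b, g t :=
    intervalIntegral.continuous_primitive (fun _ _ => hg.intervalIntegrable _ _) 0
  have hGi (z : ℂ) : IntervalIntegrable (fun s : ℝ => ∫ t in (0 : ℝ)..(z.re + z.im * s), g t)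
      volume (-1) 1 :=
    (hG.comp (by fun_prop : Continuous fun s : ℝ => z.re + z.im * s)).intervalIntegrable _ _
  have i1 := intervalIntegrable_comp_line hg z.re z.im (-1) 1
  have i2 := intervalIntegrable_comp_line_mul hg z.re z.im (-1) 1
  have e : ((expand g z).re - 2 * z.re) * (w.re - z.re) +
      ((expand g z).im - 2 * z.im) * (w.im - z.im) = ∫ s in (-1 : ℝ)..1,
        g (z.re + z.im * s) * ((w.re + w.im * s) - (z.re + z.im * s)) := by
    simp only [expand, add_sub_cancel_left]
    rw [← intervalIntegral.integral_mul_const, ← intervalIntegral.integral_mul_const,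
      ← intervalIntegral.integral_add (i1.mul_const _) (i2.mul_const _)]
    congr 1
    funext s
    ring
  rw [e, potential, potential, ← intervalIntegral.integral_sub (hGi w) (hGi z)]
  refine intervalIntegral.integral_mono_on (by norm_num)
    (Continuous.intervalIntegrable (by fun_prop) _ _) ((hGi w).sub (hGi z)) fun s _ => ?_
  rw [intervalIntegral.integral_interval_sub_left (hg.intervalIntegrable _ _)
    (hg.intervalIntegrable _ _)]
  exact mul_sub_le_integral hg hm _ _

/-- The equation `expand g z = w` is the critical point equation of the strongly convex functional
`F`. -/
theorem surjective_expand (hg : Continuous g) (hm : Monotone g) :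
    Function.Surjective (expand g) := by
  intro w
  set F : ℂ → ℝ := fun z => z.re ^ 2 + z.im ^ 2 + potential g z - (w.re * z.re + w.im * z.im)
    with hF
  have hFc : Continuous F := by
    have := continuous_potential hg
    fun_prop
  have hsub (z z' : ℂ) : ((expand g z).re - w.re) * (z'.re - z.re) +
      ((expand g z).im - w.im) * (z'.im - z.im) + (z'.re - z.re) ^ 2 + (z'.im - z.im) ^ 2 ≤
      F z' - F z := by
    have := potential_subgradient hg hm z z'
    simp only [hF]
    nlinarith
  obtain ⟨z, hz⟩ : ∃ z, ∀ z', F z ≤ F z' := by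
    -- Coercivity: with `b = expand g 0 - w`, the subgradient inequality at 0 gives `F z' - F 0 ≥
    -- ‖z'‖ (‖z'‖ - ‖b‖)`.
    refine hFc.exists_forall_le' 0 ?_
    filter_upwards [(tendsto_norm_cocompact_atTop (E := ℂ)).eventually_ge_atTop
      (‖expand g 0 - w‖)] with z' hz'
    have h := hsub 0 z'
    simp only [Complex.zero_re, Complex.zero_im, sub_zero] at h
    set b := expand g 0 - w with hb
    have hbr : (expand g 0).re - w.re = b.re := by simp [hb]
    have hbi : (expand g 0).im - w.im = b.im := by simp [hb]
    rw [hbr, hbi] at h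
    have ha : ‖z'‖ ^ 2 = z'.re ^ 2 + z'.im ^ 2 := by
      rw [← Complex.normSq_eq_norm_sq, Complex.normSq_apply]; ring
    have hb2 : ‖b‖ ^ 2 = b.re ^ 2 + b.im ^ 2 := by
      rw [← Complex.normSq_eq_norm_sq, Complex.normSq_apply]; ring
    have hcs : -(‖b‖ * ‖z'‖) ≤ b.re * z'.re + b.im * z'.im := by
      refine abs_le_of_sq_le_sq' ?_ (by positivity) |>.1
      rw [mul_pow, ha, hb2]
      nlinarith [sq_nonneg (b.re * z'.im - b.im * z'.re)]
    nlinarith [norm_nonneg z', norm_nonneg b]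
  refine ⟨z, ?_⟩
  set v := w - expand g z with hv
  -- The subgradient inequality is based at `z + t v`, so `F` need not be differentiated; letting `t
  -- → 0` gives `-‖v‖² ≥ 0`.
  have hpos : ∀ t : ℝ, 0 < t → 0 ≤ ((expand g (z + t * v)).re - w.re) * v.re +
      ((expand g (z + t * v)).im - w.im) * v.im := by
    intro t ht
    have h := hsub (z + t * v) z
    have h' := hz (z + t * v)
    simp only [Complex.add_re, Complex.add_im, Complex.re_ofReal_mul, Complex.im_ofReal_mul] at h
    have : 0 ≤ t * (((expand g (z + t * v)).re - w.re) * v.re +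
      ((expand g (z + t * v)).im - w.im) * v.im) := by nlinarith
    exact nonneg_of_mul_nonneg_right this ht
  have hc : Continuous fun t : ℝ => ((expand g (z + t * v)).re - w.re) * v.re +
      ((expand g (z + t * v)).im - w.im) * v.im := by
    have := continuous_expand hg
    fun_prop
  have h0 : 0 ≤ ((expand g (z + (0 : ℝ) * v)).re - w.re) * v.re +
      ((expand g (z + (0 : ℝ) * v)).im - w.im) * v.im :=
    ge_of_tendsto ((hc.tendsto 0).mono_left nhdsWithin_le_nhds)
      (eventually_nhdsWithin_of_forall (s := Ioi 0) hpos)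
  have hvr : v.re = w.re - (expand g z).re := by simp [hv]
  have hvi : v.im = w.im - (expand g z).im := by simp [hv]
  simp only [Complex.ofReal_zero, zero_mul, add_zero] at h0
  have hr : w.re - (expand g z).re = 0 := by
    rw [hvr, hvi] at h0
    nlinarith [sq_nonneg (w.im - (expand g z).im), sq_nonneg (w.re - (expand g z).re)]
  have hi : w.im - (expand g z).im = 0 := by
    rw [hvr, hvi] at h0
    nlinarith [sq_nonneg (w.im - (expand g z).im), sq_nonneg (w.re - (expand g z).re)]
  apply Complex.ext <;> linarith

theorem antilipschitz_expand (hg : Continuous g) (hm : Monotone g) :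
    AntilipschitzWith 1 (expand g) :=
  AntilipschitzWith.of_le_mul_dist fun z w => by
    rw [dist_eq_norm, dist_eq_norm, NNReal.coe_one, one_mul]
    linarith [two_mul_norm_sub_le hg hm z w, norm_nonneg (z - w)]

/-- `expand g` as a homeomorphism of the plane. -/
noncomputable def expandHomeo (hg : Continuous g) (hm : Monotone g) : ℂ ≃ₜ ℂ where
  toEquiv := Equiv.ofBijective (expand g)
    ⟨(antilipschitz_expand hg hm).injective, surjective_expand hg hm⟩
  continuous_toFun := continuous_expand hg
  continuous_invFun := ((antilipschitz_expand hg hm).to_rightInverse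
    (Equiv.ofBijective (expand g) _).right_inv).continuous

end Surjective

/-! ### The homeomorphism of the plane extending the lift -/

namespace IsCircleLift

variable {g k : ℝ → ℝ}

theorem exists_abs_sub_le (hg : IsCircleLift g) : ∃ C, 0 ≤ C ∧ ∀ x, |g x - x| ≤ C := by
  have hp : Function.Periodic (fun x => g x - x) (2 * Real.pi) := fun x => by
    simp only [hg.map_add]; ring
  have hc : Continuous fun x => g x - x := hg.continuous.sub continuous_id
  obtain ⟨C, hC⟩ := (isCompact_Icc (a := (0 : ℝ)) (b := 2 * Real.pi)).exists_bound_of_continuousOn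
    hc.continuousOn
  have h (x : ℝ) : |g x - x| ≤ C := by
    obtain ⟨y, hy, hxy⟩ := hp.exists_mem_Ico₀ Real.two_pi_pos x
    have := hC y (Ico_subset_Icc_self hy)
    exact hxy ▸ this
  exact ⟨C, (abs_nonneg _).trans (h 0), h⟩

/-- The homeomorphism `R⁻¹ ∘ P` of the plane, where `P` and `R` are the maps `expand g`
and `expand k`. -/
noncomputable def planeHomeo (hg : IsCircleLift g) (hk : IsCircleLift k) : ℂ ≃ₜ ℂ :=
  (expandHomeo hg.continuous hg.monotone).trans (expandHomeo hk.continuous hk.monotone).symm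

theorem expand_planeHomeo (hg : IsCircleLift g) (hk : IsCircleLift k) (z : ℂ) :
    expand k (planeHomeo hg hk z) = expand g z :=
  (expandHomeo hk.continuous hk.monotone).apply_symm_apply _

theorem planeHomeo_eq_iff (hg : IsCircleLift g) (hk : IsCircleLift k) {z w : ℂ} :
    planeHomeo hg hk z = w ↔ expand g z = expand k w := by
  rw [← expand_planeHomeo hg hk z]
  exact (antilipschitz_expand hk.continuous hk.monotone).injective.eq_iff.symm

theorem planeHomeo_add_period (hg : IsCircleLift g) (hk : IsCircleLift k) (z : ℂ) :
    planeHomeo hg hk (z + ((2 * Real.pi : ℝ) : ℂ)) =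
      planeHomeo hg hk z + ((2 * Real.pi : ℝ) : ℂ) := by
  rw [planeHomeo_eq_iff, expand_add_period hg, expand_add_period hk, expand_planeHomeo]

/-- As `R (H z) = P z`, expansion by `R` gives `2 ‖H z - z‖ ≤ ‖P z - R z‖`, which is bounded because
`g - k` is. -/
theorem exists_norm_planeHomeo_sub_le (hg : IsCircleLift g) (hk : IsCircleLift k) :
    ∃ C, 0 ≤ C ∧ ∀ z, ‖planeHomeo hg hk z - z‖ ≤ C := by
  obtain ⟨A, hA0, hA⟩ := hg.exists_abs_sub_le
  obtain ⟨B, hB0, hB⟩ := hk.exists_abs_sub_le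
  have hAB (x : ℝ) : |g x - k x| ≤ A + B := by
    have e : g x - k x = (g x - x) - (k x - x) := by ring
    rw [e]
    exact (abs_sub _ _).trans (add_le_add (hA x) (hB x))
  refine ⟨4 * (A + B), by positivity, fun z => ?_⟩
  have h1 := two_mul_norm_sub_le hk.continuous hk.monotone (planeHomeo hg hk z) z
  rw [expand_planeHomeo] at h1
  have h2 := norm_expand_sub_expand_le hg.continuous hk.continuous hAB z
  linarith [norm_nonneg (planeHomeo hg hk z - z)]

/-- `R⁻¹` is a contraction whatever `k` is, so local bounds for `H` involve `g` alone. -/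
theorem norm_planeHomeo_sub_le (hg : IsCircleLift g) (hk : IsCircleLift k) (z w : ℂ) :
    ‖planeHomeo hg hk w - planeHomeo hg hk z‖ ≤ ‖expand g w - expand g z‖ := by
  have h1 := two_mul_norm_sub_le hk.continuous hk.monotone (planeHomeo hg hk w) (planeHomeo hg hk z)
  rw [expand_planeHomeo, expand_planeHomeo] at h1
  linarith [norm_nonneg (planeHomeo hg hk w - planeHomeo hg hk z)]

/-- If `H z` lay below the axis, so would `R (H z) = P z`; then `z` would have to be real, and `P z`
with it. -/
theorem planeHomeo_im_nonneg (hg : IsCircleLift g) (hk : IsCircleLift k) {z : ℂ}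
    (hz : 0 ≤ z.im) : 0 ≤ (planeHomeo hg hk z).im := by
  by_contra! h
  have h1 := two_mul_im_sq_le hg.continuous hg.monotone z
  have h2 := two_mul_im_sq_le hk.continuous hk.monotone (planeHomeo hg hk z)
  rw [expand_planeHomeo] at h2
  set u := (planeHomeo hg hk z).im
  have h3 : (expand g z).im < 0 := by
    by_contra! h'
    nlinarith [mul_nonneg h' (neg_pos.2 h).le, sq_pos_of_neg h]
  have h4 : z.im = 0 := by nlinarith [mul_nonneg hz (neg_pos.2 h3).le, sq_nonneg z.im]
  have h5 : z = (z.re : ℂ) := by apply Complex.ext <;> simp [h4]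
  rw [h5, expand_ofReal] at h3
  simp at h3

theorem planeHomeo_ofReal (hg : IsCircleLift g) (hk : IsCircleLift k)
    (hinv : Function.LeftInverse k g) (x : ℝ) : planeHomeo hg hk x = g x := by
  rw [planeHomeo_eq_iff, expand_ofReal, expand_ofReal, hinv x, add_comm]

theorem sub_le_of_abs_sub_le {C : ℝ} (hC : ∀ x, |g x - x| ≤ C) (x y : ℝ) :
    g (x + 2 * y) - g (x - 2 * y) ≤ 4 * y + 2 * C := by
  have h1 := abs_le.1 (hC (x + 2 * y))
  have h2 := abs_le.1 (hC (x - 2 * y))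
  linarith [h1.2, h2.1]

end IsCircleLift

/-! ### Descent to the disk through the exponential -/

/-- A continuous self-map of the plane, commuting with the translation by `2π` and at bounded
distance from the identity. -/
structure IsPlaneLift (H : ℂ → ℂ) : Prop where
  continuous : Continuous H
  map_add : ∀ z, H (z + ((2 * Real.pi : ℝ) : ℂ)) = H z + ((2 * Real.pi : ℝ) : ℂ)
  exists_norm_sub_le : ∃ C, 0 ≤ C ∧ ∀ z, ‖H z - z‖ ≤ C

/-- The self-map of the plane which fixes the origin and satisfies
`exp (i z) ↦ exp (i H z)`. -/
noncomputable def descend (H : ℂ → ℂ) (w : ℂ) : ℂ :=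
  if w = 0 then 0 else Complex.exp (Complex.I * H (-Complex.I * Complex.log w))

@[simp]
theorem descend_zero (H : ℂ → ℂ) : descend H 0 = 0 := by simp [descend]

theorem exp_I_mul_neg_I_mul_log {w : ℂ} (hw : w ≠ 0) :
    Complex.exp (Complex.I * (-Complex.I * Complex.log w)) = w := by
  rw [← mul_assoc, mul_neg, Complex.I_mul_I, neg_neg, one_mul, Complex.exp_log hw]

theorem exists_exp_I_mul_eq {w : ℂ} (hw : w ≠ 0) : ∃ z, Complex.exp (Complex.I * z) = w :=
  ⟨_, exp_I_mul_neg_I_mul_log hw⟩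

theorem norm_exp_I_mul (z : ℂ) : ‖Complex.exp (Complex.I * z)‖ = Real.exp (-z.im) := by
  rw [Complex.norm_exp]; simp

theorem descend_id : descend id = id := by
  funext w
  by_cases hw : w = 0
  · simp [hw]
  · simp only [descend, hw, if_false, id]
    exact exp_I_mul_neg_I_mul_log hw

namespace IsPlaneLift

variable {H K : ℂ → ℂ}

theorem descend_exp (hH : IsPlaneLift H) (z : ℂ) :
    descend H (Complex.exp (Complex.I * z)) = Complex.exp (Complex.I * H z) := by
  have hp : Function.Periodic (fun z => H z - z) ((2 * Real.pi : ℝ) : ℂ) := fun z => by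
    simp only [hH.map_add]; ring
  rw [descend, if_neg (Complex.exp_ne_zero _)]
  obtain ⟨n, hn⟩ := Complex.exp_eq_exp_iff_exists_int.1
    (Complex.exp_log (Complex.exp_ne_zero (Complex.I * z)))
  have e : -Complex.I * Complex.log (Complex.exp (Complex.I * z)) =
      z + n * ((2 * Real.pi : ℝ) : ℂ) := by
    rw [hn]
    push_cast
    linear_combination (-z - n * (2 * Real.pi)) * Complex.I_mul_I
  have h2 : H (z + n * ((2 * Real.pi : ℝ) : ℂ)) - (z + n * ((2 * Real.pi : ℝ) : ℂ)) = H z - z :=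
    hp.int_mul n z
  rw [e, Complex.exp_eq_exp_iff_exists_int]
  refine ⟨n, ?_⟩
  push_cast at h2 ⊢
  linear_combination Complex.I * h2

/-- `H` changes the imaginary part by at most `C`, hence the modulus by a factor at most `exp C`.
This linear bound controls the map at the origin, which the exponential omits. -/
theorem exists_norm_descend_le (hH : IsPlaneLift H) :
    ∃ C, 1 ≤ C ∧ ∀ w, ‖descend H w‖ ≤ C * ‖w‖ := by
  obtain ⟨C, hC0, hC⟩ := hH.exists_norm_sub_le
  refine ⟨Real.exp C, Real.one_le_exp hC0, fun w => ?_⟩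
  by_cases hw : w = 0
  · simp [hw]
  · obtain ⟨z, rfl⟩ := exists_exp_I_mul_eq hw
    rw [hH.descend_exp, norm_exp_I_mul, norm_exp_I_mul, ← Real.exp_add]
    refine Real.exp_le_exp.2 ?_
    have := (abs_le.1 ((Complex.abs_im_le_norm _).trans (hC z))).1
    rw [Complex.sub_im] at this
    linarith

theorem descend_comp (hH : IsPlaneLift H) (hK : IsPlaneLift K) (hHK : IsPlaneLift (H ∘ K)) :
    descend H ∘ descend K = descend (H ∘ K) := by
  funext w
  by_cases hw : w = 0
  · simp [hw]
  · obtain ⟨z, rfl⟩ := exists_exp_I_mul_eq hw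
    rw [Function.comp_apply, hK.descend_exp, hH.descend_exp, hHK.descend_exp, Function.comp_apply]

theorem continuous_descend (hH : IsPlaneLift H) : Continuous (descend H) := by
  rw [continuous_iff_continuousAt]
  intro w
  by_cases hw : w = 0
  · obtain ⟨C, hC1, hC⟩ := hH.exists_norm_descend_le
    rw [ContinuousAt, hw, descend_zero]
    refine squeeze_zero_norm hC ?_
    have : Continuous fun w : ℂ => C * ‖w‖ := by fun_prop
    simpa using this.tendsto 0
  · obtain ⟨z, hz⟩ := exists_exp_I_mul_eq hw
    -- The logarithm of `u / w` is taken near 1, away from the branch cut.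
    have hL : ContinuousAt (fun u => z - Complex.I * Complex.log (u / w)) w := by
      refine continuousAt_const.sub (continuousAt_const.mul (ContinuousAt.clog ?_ ?_))
      · exact continuousAt_id.div_const w
      · simp [div_self hw]
    have hc : ContinuousAt (fun u => Complex.exp (Complex.I *
        H (z - Complex.I * Complex.log (u / w)))) w :=
      Complex.continuous_exp.continuousAt.comp
        (continuousAt_const.mul (hH.continuous.continuousAt.comp hL))
    refine hc.congr ?_
    filter_upwards [isOpen_ne.mem_nhds hw] with u hu
    rw [← hH.descend_exp]
    congr 1
    rw [mul_sub, ← mul_assoc, Complex.I_mul_I, neg_one_mul, sub_neg_eq_add, Complex.exp_add, hz,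
      Complex.exp_log (div_ne_zero hu hw), mul_div_cancel₀ _ hw]

theorem id : IsPlaneLift id := ⟨continuous_id, fun _ => rfl, 0, le_rfl, fun _ => by simp⟩

theorem norm_descend_le_one (hH : IsPlaneLift H) (hi : ∀ z : ℂ, 0 ≤ z.im → 0 ≤ (H z).im) {w : ℂ}
    (hw : ‖w‖ ≤ 1) : ‖descend H w‖ ≤ 1 := by
  by_cases h0 : w = 0
  · simp [h0]
  · obtain ⟨z, rfl⟩ := exists_exp_I_mul_eq h0
    rw [norm_exp_I_mul, Real.exp_le_one_iff, neg_nonpos] at hw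
    rw [hH.descend_exp, norm_exp_I_mul, Real.exp_le_one_iff, neg_nonpos]
    exact hi z hw

end IsPlaneLift

/-- The homeomorphism of the closed disk induced by a homeomorphism of the plane which is a plane
lift and preserves the closed upper half-plane. -/
noncomputable def diskHomeo (H : ℂ ≃ₜ ℂ) (h1 : IsPlaneLift H) (h2 : IsPlaneLift H.symm)
    (i1 : ∀ z : ℂ, 0 ≤ z.im → 0 ≤ (H z).im) (i2 : ∀ z : ℂ, 0 ≤ z.im → 0 ≤ (H.symm z).im) :
    closedDisk ≃ₜ closedDisk where
  toFun w := ⟨descend H w, mem_closedBall_zero_iff.2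
    (h1.norm_descend_le_one i1 (mem_closedBall_zero_iff.1 w.2))⟩
  invFun w := ⟨descend H.symm w, mem_closedBall_zero_iff.2
    (h2.norm_descend_le_one i2 (mem_closedBall_zero_iff.1 w.2))⟩
  left_inv w := Subtype.ext <| by
    have e : (H.symm : ℂ → ℂ) ∘ H = id := H.symm_comp_self
    have := congr_fun (h2.descend_comp h1 (e ▸ IsPlaneLift.id)) (w : ℂ)
    rwa [e, descend_id] at this
  right_inv w := Subtype.ext <| by
    have e : (H : ℂ → ℂ) ∘ H.symm = id := H.self_comp_symm
    have := congr_fun (h1.descend_comp h2 (e ▸ IsPlaneLift.id)) (w : ℂ)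
    rwa [e, descend_id] at this
  continuous_toFun := (h1.continuous_descend.comp continuous_subtype_val).subtype_mk _
  continuous_invFun := (h2.continuous_descend.comp continuous_subtype_val).subtype_mk _

/-! ### The extension of the circle map and its pointwise Lipschitz bound -/

namespace IsCircleLift

variable {g k : ℝ → ℝ}

theorem isPlaneLift (hg : IsCircleLift g) (hk : IsCircleLift k) :
    IsPlaneLift (planeHomeo hg hk) :=
  ⟨(planeHomeo hg hk).continuous, planeHomeo_add_period hg hk, exists_norm_planeHomeo_sub_le hg hk⟩

/-- The self-homeomorphism of the closed disk built from two circle lifts `g` and `k`. When `k` is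
inverse to `g` it extends the circle homeomorphism with lift `g`. -/
noncomputable def extension (hg : IsCircleLift g) (hk : IsCircleLift k) :
    closedDisk ≃ₜ closedDisk :=
  diskHomeo (planeHomeo hg hk) (isPlaneLift hg hk) (isPlaneLift hk hg)
    (fun _ => planeHomeo_im_nonneg hg hk) (fun _ => planeHomeo_im_nonneg hk hg)

theorem extension_apply (hg : IsCircleLift g) (hk : IsCircleLift k) (w : closedDisk) :
    (extension hg hk w : ℂ) = descend (planeHomeo hg hk) w := rfl

/-- The coefficient of the pointwise Lipschitz bound for the extension. -/
noncomputable def slope (g : ℝ → ℝ) (x y : ℝ) : ℝ :=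
  2 + 8 * ((g (x + 2 * y) - g (x - 2 * y)) / y)

theorem two_le_slope (hg : IsCircleLift g) (x : ℝ) {y : ℝ} (hy : 0 < y) : 2 ≤ slope g x y := by
  have := hg.monotone (show x - 2 * y ≤ x + 2 * y by linarith)
  have : 0 ≤ (g (x + 2 * y) - g (x - 2 * y)) / y := div_nonneg (by linarith) hy.le
  simp only [slope]
  linarith

theorem slope_le {C : ℝ} (hC : ∀ x, |g x - x| ≤ C) (x : ℝ) {y : ℝ} (hy : 0 < y) :
    slope g x y ≤ 34 + 16 * C / y := by
  have h := sub_le_of_abs_sub_le hC x y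
  have : (g (x + 2 * y) - g (x - 2 * y)) / y ≤ 4 + 2 * C / y := by
    rw [div_le_iff₀ hy, add_mul, div_mul_cancel₀ _ hy.ne']
    exact h
  have e : 16 * C / y = 8 * (2 * C / y) := by ring
  rw [slope, e]
  linarith

/-- In logarithmic coordinates the increment is about `d = (u - w) / w`, so the factor `‖w‖` from
the linear bound cancels. The three terms of the minimum permit, in order, the estimate of `log (1 +
d)`, the Lipschitz bound for `expand g` within `z.im / 2`, and the estimate of `exp - 1` on
increments of size at most 1. -/
theorem norm_descend_planeHomeo_sub_le (hg : IsCircleLift g) (hk : IsCircleLift k) :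
    ∃ A, 0 ≤ A ∧ ∀ z u : ℂ, 0 < z.im → ‖u - Complex.exp (Complex.I * z)‖ ≤
      min (1 / 2) (min (z.im / 3) (2 / (3 * slope g z.re z.im))) * ‖Complex.exp (Complex.I * z)‖ →
      ‖descend (planeHomeo hg hk) u - descend (planeHomeo hg hk) (Complex.exp (Complex.I * z))‖ ≤
        A * slope g z.re z.im * ‖u - Complex.exp (Complex.I * z)‖ := by
  set H := planeHomeo hg hk
  have hH : IsPlaneLift H := isPlaneLift hg hk
  obtain ⟨A, hA1, hA⟩ := hH.exists_norm_descend_le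
  refine ⟨3 * A, by positivity, fun z u hz hu => ?_⟩
  set w := Complex.exp (Complex.I * z) with hw
  have hw0 : w ≠ 0 := Complex.exp_ne_zero _
  have hwn : 0 < ‖w‖ := norm_pos_iff.2 hw0
  set Λ := slope g z.re z.im with hΛ
  have hΛ2 : 2 ≤ Λ := hg.two_le_slope z.re hz
  set d := (u - w) / w with hd
  have hdn : ‖d‖ = ‖u - w‖ / ‖w‖ := norm_div _ _
  have hdle : ‖d‖ ≤ min (1 / 2) (min (z.im / 3) (2 / (3 * Λ))) := by
    rw [hdn, div_le_iff₀ hwn]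
    exact hu
  have hd1 : ‖d‖ ≤ 1 / 2 := hdle.trans (min_le_left _ _)
  have hd2 : ‖d‖ ≤ z.im / 3 := hdle.trans ((min_le_right _ _).trans (min_le_left _ _))
  have hd3 : ‖d‖ ≤ 2 / (3 * Λ) := hdle.trans ((min_le_right _ _).trans (min_le_right _ _))
  set z' := z - Complex.I * Complex.log (1 + d) with hz'
  have h1d : 1 + d ≠ 0 := by
    intro h
    have : d = -1 := by linear_combination h
    rw [this] at hd1
    norm_num at hd1
  have hzz : ‖z' - z‖ ≤ 3 / 2 * ‖d‖ := by
    have : z' - z = -(Complex.I * Complex.log (1 + d)) := by rw [hz']; ring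
    rw [this, norm_neg, norm_mul, Complex.norm_I, one_mul]
    exact Complex.norm_log_one_add_half_le_self hd1
  have hu' : Complex.exp (Complex.I * z') = u := by
    rw [hz', mul_sub, ← mul_assoc, Complex.I_mul_I, neg_one_mul, sub_neg_eq_add, Complex.exp_add,
      Complex.exp_log h1d, ← hw, hd]
    field_simp
    ring
  have hHz : ‖H z' - H z‖ ≤ Λ * (3 / 2 * ‖d‖) :=
    calc _ ≤ ‖expand g z' - expand g z‖ := norm_planeHomeo_sub_le hg hk z z'
      _ ≤ Λ * ‖z' - z‖ := norm_expand_sub_le hg.continuous hg.monotone hz (by linarith)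
      _ ≤ _ := by gcongr
  have hsmall : Λ * (3 / 2 * ‖d‖) ≤ 1 := by
    rw [le_div_iff₀ (by positivity)] at hd3
    linarith
  rw [← hu', hw, hH.descend_exp, hH.descend_exp]
  have e : Complex.exp (Complex.I * H z') - Complex.exp (Complex.I * H z) =
      Complex.exp (Complex.I * H z) * (Complex.exp (Complex.I * (H z' - H z)) - 1) := by
    rw [mul_sub, mul_one, ← Complex.exp_add]
    congr 2
    ring
  have hn : ‖Complex.I * (H z' - H z)‖ = ‖H z' - H z‖ := by simp
  have h1 : ‖Complex.exp (Complex.I * (H z' - H z)) - 1‖ ≤ 2 * ‖H z' - H z‖ := by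
    rw [← hn]
    exact Complex.norm_exp_sub_one_le (by rw [hn]; linarith)
  have h2 : ‖Complex.exp (Complex.I * H z)‖ ≤ A * ‖w‖ := by
    rw [← hH.descend_exp]
    exact hA _
  rw [e, norm_mul, ← hw, hu']
  calc _ ≤ (A * ‖w‖) * (2 * (Λ * (3 / 2 * ‖d‖))) := by
        gcongr
        exact h1.trans (by gcongr)
    _ = 3 * A * Λ * ‖u - w‖ := by rw [hdn]; field_simp

end IsCircleLift

/-! ### From locally Lipschitz maps of finite energy to Orlicz–Sobolev maps -/

/-- Locally Lipschitz bounded maps of the disk with finite `Φ`-energy. -/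
structure HasFiniteEnergy (Φ : ℝ → ℝ) (f : ℂ → ℂ) : Prop where
  lipschitzOn : ∀ r : ℝ, r < 1 → ∃ C, LipschitzOnWith C f (Metric.closedBall 0 r)
  bounded : ∃ B, ∀ w ∈ disk, ‖f w‖ ≤ B
  lintegral_lt_top : ∫⁻ z in disk, ENNReal.ofReal (Φ ‖fderiv ℝ f z‖) < ⊤

/-- A Lipschitz map of the plane satisfies the integration by parts formula with its almost
everywhere defined differential. -/
theorem integral_fderiv_smul_eq_of_lipschitz {F : ℂ → ℂ} {C : NNReal} (hF : LipschitzWith C F)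
    {u : ℂ → ℝ} (hu : ContDiff ℝ ∞ u) (huc : HasCompactSupport u) (v : ℂ) :
    ∫ z, (fderiv ℝ u z v) • F z = - ∫ z, u z • fderiv ℝ F z v := by
  have hu1 : Continuous fun z => fderiv ℝ u z v :=
    (hu.continuous_fderiv (by simp)).clm_apply continuous_const
  have i1 : Integrable fun z => (fderiv ℝ u z v) • F z := by
    refine (hu1.smul hF.continuous).integrable_of_hasCompactSupport ?_
    exact (huc.fderiv_apply ℝ v).smul_right
  have i2 : Integrable fun z => u z • fderiv ℝ F z v := by
    have hui : Integrable u := hu.continuous.integrable_of_hasCompactSupport huc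
    have hm : AEStronglyMeasurable (fun z => fderiv ℝ F z v) :=
      (measurable_fderiv_apply_const ℝ F v).aestronglyMeasurable
    refine hui.smul_bdd (C * ‖v‖) hm (Eventually.of_forall fun z => ?_)
    exact (ContinuousLinearMap.le_opNorm _ _).trans
      (by gcongr; exact norm_fderiv_le_of_lipschitz ℝ hF)
  -- Scalar integration by parts is applied to the real and imaginary parts; Rademacher's theorem
  -- identifies the line derivatives with `fderiv` almost everywhere.
  have key (L : ℂ →L[ℝ] ℝ) (hL : LipschitzWith 1 L) :
      L (∫ z, (fderiv ℝ u z v) • F z) = L (- ∫ z, u z • fderiv ℝ F z v) := by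
    rw [map_neg, ← L.integral_comp_comm i1, ← L.integral_comp_comm i2, ← integral_neg]
    simp only [map_smul, smul_eq_mul]
    obtain ⟨D, hD⟩ := hu.lipschitzWith_of_hasCompactSupport huc (by simp)
    have h := (hL.comp hF).integral_lineDeriv_mul_eq (μ := volume) hD huc (-v)
    rw [neg_neg] at h
    have e1 (z : ℂ) : lineDeriv ℝ u z v * (L ∘ F) z = fderiv ℝ u z v * L (F z) := by
      rw [((hu.differentiable (by simp)) z).lineDeriv_eq_fderiv, Function.comp_apply]
    simp only [e1] at h
    rw [← h]
    refine integral_congr_ae ?_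
    filter_upwards [hF.ae_differentiableAt (μ := volume)] with z hz
    have hLz : HasFDerivAt (L ∘ F) (L.comp (fderiv ℝ F z)) z := L.hasFDerivAt.comp z hz.hasFDerivAt
    rw [hLz.differentiableAt.lineDeriv_eq_fderiv, hLz.fderiv]
    simp [mul_comm]
  refine Complex.ext (key Complex.reCLM ?_) (key Complex.imCLM ?_)
  · exact LipschitzWith.of_dist_le_mul fun z w => by
      rw [Real.dist_eq, dist_eq_norm, NNReal.coe_one, one_mul, ← map_sub]
      exact Complex.abs_re_le_norm (z - w)
  · exact LipschitzWith.of_dist_le_mul fun z w => by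
      rw [Real.dist_eq, dist_eq_norm, NNReal.coe_one, one_mul, ← map_sub]
      exact Complex.abs_im_le_norm (z - w)

/-- A test function is supported in a smaller disk, and `f` agrees there with a globally Lipschitz
map. -/
theorem isWeakDifferential_fderiv {f : ℂ → ℂ}
    (hf : ∀ r : ℝ, r < 1 → ∃ C, LipschitzOnWith C f (Metric.closedBall 0 r)) :
    IsWeakDifferential disk f (fderiv ℝ f) := by
  intro u hu huc hus v
  obtain ⟨r, hr1, hr⟩ := exists_lt_subset_ball (isClosed_tsupport u) hus
  obtain ⟨C, hC⟩ := hf r hr1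
  obtain ⟨F, hF, hfF⟩ := hC.extend_finite_dimension
  have hrd : Metric.ball (0 : ℂ) r ⊆ disk := Metric.ball_subset_ball hr1.le
  have h1 (z : ℂ) (hz : z ∉ tsupport u) : fderiv ℝ u z = 0 := by
    by_contra h
    exact hz (support_fderiv_subset ℝ h)
  have h2 (z : ℂ) (hz : z ∉ tsupport u) : u z = 0 := image_eq_zero_of_notMem_tsupport hz
  have e1 : ∫ z in disk, (fderiv ℝ u z v) • f z = ∫ z, (fderiv ℝ u z v) • F z := by
    rw [setIntegral_eq_integral_of_forall_compl_eq_zero]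
    · congr 1
      funext z
      by_cases hz : z ∈ tsupport u
      · rw [hfF (Metric.ball_subset_closedBall (hr hz))]
      · simp [h1 z hz]
    · intro z hz
      rw [h1 z fun h => hz (hus h)]
      simp
  have e2 : ∫ z in disk, u z • fderiv ℝ f z v = ∫ z, u z • fderiv ℝ F z v := by
    rw [setIntegral_eq_integral_of_forall_compl_eq_zero]
    · congr 1
      funext z
      by_cases hz : z ∈ tsupport u
      · have : f =ᶠ[𝓝 z] F := by
          filter_upwards [Metric.isOpen_ball.mem_nhds (hr hz)] with y hy
          exact hfF (Metric.ball_subset_closedBall hy)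
        rw [this.fderiv_eq]
      · simp [h2 z hz]
    · intro z hz
      rw [h2 z fun h => hz (hus h), zero_smul]
  rw [e1, e2]
  exact integral_fderiv_smul_eq_of_lipschitz hF hu huc v

theorem toPlane_apply (h : closedDisk → closedDisk) (z : closedDisk) : toPlane h z = h z :=
  Subtype.val_injective.extend_apply (fun z => (h z : ℂ)) 0 z

theorem memOrliczSobolev_congr {Φ : ℝ → ℝ} {Ω : Set ℂ} {f f' : ℂ → ℂ} (hΩ : MeasurableSet Ω)
    (h : EqOn f f' Ω) (hf : MemOrliczSobolev Φ Ω f) : MemOrliczSobolev Φ Ω f' := by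
  obtain ⟨h1, G, h2, h3, h4⟩ := hf
  refine ⟨h1.congr_fun h hΩ, G, h2, fun u hu huc hus v => ?_, h4⟩
  rw [← h3 u hu huc hus v]
  refine setIntegral_congr_fun hΩ fun z hz => ?_
  simp only [h hz]

namespace HasFiniteEnergy

variable {Φ : ℝ → ℝ} {f : ℂ → ℂ}

theorem continuousOn (hf : HasFiniteEnergy Φ f) : ContinuousOn f disk := by
  intro z hz
  obtain ⟨r, hr, hr1⟩ := exists_between (mem_ball_zero_iff.1 hz)
  obtain ⟨C, hC⟩ := hf.lipschitzOn r hr1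
  have : Metric.closedBall (0 : ℂ) r ∈ 𝓝 z :=
    Filter.mem_of_superset (Metric.isOpen_ball.mem_nhds (mem_ball_zero_iff.2 hr))
      Metric.ball_subset_closedBall
  exact (hC.continuousOn.continuousAt this).continuousWithinAt

theorem memOrliczSobolev (hN : IsNFunction Φ) (hf : HasFiniteEnergy Φ f) :
    MemOrliczSobolev Φ disk f := by
  have hfin : volume disk < ⊤ := measure_ball_lt_top
  obtain ⟨B, hB⟩ := hf.bounded
  refine ⟨⟨hf.continuousOn.aestronglyMeasurable measurableSet_ball,
    HasFiniteIntegral.restrict_of_bounded (C := B) hfin ?_⟩, fderiv ℝ f, ?_,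
    isWeakDifferential_fderiv hf.lipschitzOn, hf.lintegral_lt_top⟩
  · exact (ae_restrict_iff' measurableSet_ball).2 (Eventually.of_forall hB)
  · refine ⟨(measurable_fderiv ℝ f).aestronglyMeasurable, ?_⟩
    obtain ⟨T, hT⟩ := eventually_atTop.1 (hN.tendsto_atTop.eventually_ge_atTop 1)
    -- Superlinear growth gives `t ≤ T + Φ t`, so on a set of finite measure finite energy makes the
    -- differential integrable.
    have hle (t : ℝ) (ht : 0 ≤ t) : ENNReal.ofReal t ≤ ENNReal.ofReal T + ENNReal.ofReal (Φ t) := by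
      rcases le_total t T with h | h
      · exact (ENNReal.ofReal_le_ofReal h).trans le_self_add
      · refine (ENNReal.ofReal_le_ofReal ?_).trans le_add_self
        rcases eq_or_lt_of_le ht with h0 | h0
        · rw [← h0, hN.map_zero]
        · simpa using (le_div_iff₀ h0).1 (hT t h)
    rw [hasFiniteIntegral_iff_norm]
    refine (lintegral_mono fun z => hle _ (norm_nonneg _)).trans_lt ?_
    rw [lintegral_add_left measurable_const, lintegral_const, Measure.restrict_apply_univ]
    exact ENNReal.add_lt_top.2 ⟨ENNReal.mul_lt_top ENNReal.ofReal_lt_top hfin, hf.lintegral_lt_top⟩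

theorem conj_comp (hf : HasFiniteEnergy Φ f) : HasFiniteEnergy Φ (fun z => starRingEnd ℂ (f z)) where
  lipschitzOn r hr := by
    obtain ⟨C, hC⟩ := hf.lipschitzOn r hr
    refine ⟨C, LipschitzOnWith.of_dist_le_mul fun x hx y hy => ?_⟩
    rw [Complex.dist_conj_conj]
    exact hC.dist_le_mul x hx y hy
  bounded := by
    obtain ⟨B, hB⟩ := hf.bounded
    exact ⟨B, fun w hw => by rw [Complex.norm_conj]; exact hB w hw⟩
  lintegral_lt_top := by
    have (z : ℂ) : ‖fderiv ℝ (fun z => starRingEnd ℂ (f z)) z‖ = ‖fderiv ℝ f z‖ := by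
      have h : fderiv ℝ (fun z => starRingEnd ℂ (f z)) z =
          (Complex.conjLIE : ℂ →L[ℝ] ℂ).comp (fderiv ℝ f z) := Complex.conjLIE.comp_fderiv
      rw [h]
      exact Complex.conjLIE.toLinearIsometry.norm_toContinuousLinearMap_comp
    simp only [this]
    exact hf.lintegral_lt_top

theorem comp_conj (hf : HasFiniteEnergy Φ f) : HasFiniteEnergy Φ (fun z => f (starRingEnd ℂ z)) where
  lipschitzOn r hr := by
    obtain ⟨C, hC⟩ := hf.lipschitzOn r hr
    refine ⟨C, LipschitzOnWith.of_dist_le_mul fun x hx y hy => ?_⟩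
    rw [← Complex.dist_conj_conj x y]
    exact hC.dist_le_mul _ (by simpa using hx) _ (by simpa using hy)
  bounded := by
    obtain ⟨B, hB⟩ := hf.bounded
    exact ⟨B, fun w hw => hB _ (by simpa using hw)⟩
  lintegral_lt_top := by
    have hn (z : ℂ) : ‖fderiv ℝ (fun z => f (starRingEnd ℂ z)) z‖ =
        ‖fderiv ℝ f (starRingEnd ℂ z)‖ := by
      have h := Complex.conjLIE.toContinuousLinearEquiv.comp_right_fderiv (f := f) (x := z)
      have h' : fderiv ℝ (fun z => f (starRingEnd ℂ z)) z = (fderiv ℝ f (starRingEnd ℂ z)).comp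
        (Complex.conjLIE.toContinuousLinearEquiv : ℂ →L[ℝ] ℂ) := h
      rw [h']
      exact ContinuousLinearMap.opNorm_comp_linearIsometryEquiv _ Complex.conjLIE
    simp only [hn]
    have hp := Complex.conjLIE.measurePreserving
    have h := hp.setLIntegral_comp_preimage_emb
      Complex.conjLIE.toHomeomorph.measurableEmbedding
      (fun z => ENNReal.ofReal (Φ ‖fderiv ℝ f z‖)) disk
    have hd : Complex.conjLIE ⁻¹' disk = disk := by ext z; simp
    rw [hd] at h
    exact h.trans_lt hf.lintegral_lt_top

end HasFiniteEnergy

/-! ### The energy estimate on slices -/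

namespace IsNFunction

variable {Φ : ℝ → ℝ}

theorem nonneg (hN : IsNFunction Φ) {t : ℝ} (ht : 0 ≤ t) : 0 ≤ Φ t := by
  rw [← hN.map_zero]
  exact hN.monotoneOn self_mem_Ici ht ht

/-- On `[0, m]` the graph lies below the chord through the origin. -/
theorem le_div_mul (hN : IsNFunction Φ) {t m : ℝ} (ht : 0 ≤ t) (htm : t ≤ m) (hm : 0 < m) :
    Φ t ≤ t / m * Φ m := by
  have h1 : t / m ≤ 1 := (div_le_one hm).2 htm
  have h := hN.convexOn.2 (show m ∈ Ici 0 from hm.le) (self_mem_Ici (a := (0 : ℝ)))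
    (div_nonneg ht hm.le) (sub_nonneg.2 h1) (by ring)
  simpa [hN.map_zero, div_mul_cancel₀ _ hm.ne'] using h

/-- Substituting `s = B / t` yields `B² Φ t / t³`; the condition `S < B` keeps `t` in `(1, ∞)`. -/
theorem lintegral_mul_comp_div_lt_top (hN : IsNFunction Φ)
    (hint : IntegrableOn (fun t : ℝ => Φ t / t ^ 3) (Ioi 1)) {S B : ℝ} (hS : 0 < S) (hB : S < B) :
    ∫⁻ s in Ioc 0 S, ENNReal.ofReal (s * Φ (B / s)) < ⊤ := by
  have hB0 : 0 < B := hS.trans hB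
  have hsub : Ioc 0 S ⊆ (fun t => B / t) '' Ioi 1 := fun s hs =>
    ⟨B / s, (one_lt_div hs.1).2 (hs.2.trans_lt hB), div_div_cancel₀ hB0.ne'⟩
  refine (lintegral_mono_set hsub).trans_lt ?_
  have hder : ∀ t ∈ Ioi (1 : ℝ), HasDerivWithinAt (fun t => B / t) (-B / t ^ 2) (Ioi 1) t := by
    intro t ht
    have ht0 : t ≠ 0 := (zero_lt_one.trans ht).ne'
    have := ((hasDerivAt_id t).inv ht0).const_mul B
    refine (this.congr_deriv ?_).hasDerivWithinAt
    simp [div_eq_mul_inv]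
  have hinj : InjOn (fun t => B / t) (Ioi 1) := by
    intro s _ t _ hst
    have := congrArg (fun u => B / u) hst
    simpa [div_div_cancel₀ hB0.ne'] using this
  rw [lintegral_image_eq_lintegral_abs_deriv_mul measurableSet_Ioi hder hinj]
  have hi := (hint.const_mul (B ^ 2)).hasFiniteIntegral
  rw [hasFiniteIntegral_iff_ofReal] at hi
  · refine lt_of_eq_of_lt (setLIntegral_congr_fun measurableSet_Ioi fun t ht => ?_) hi
    have ht0 : 0 < t := zero_lt_one.trans ht
    rw [← ENNReal.ofReal_mul (abs_nonneg _), div_div_cancel₀ hB0.ne', abs_div, abs_neg,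
      abs_of_pos hB0, abs_of_pos (by positivity)]
    congr 1
    field_simp
  · refine (ae_restrict_iff' measurableSet_Ioi).2 (Eventually.of_forall fun t ht => ?_)
    have ht0 : (0 : ℝ) < t := zero_lt_one.trans ht
    have := hN.nonneg ht0.le
    simp only [Pi.zero_apply]
    positivity

/-- Functions bounded by `B / s` on the slice at height `s`, with bounded mean on the slices, have
finite `Φ`-energy. -/
theorem lintegral_lintegral_lt_top (hN : IsNFunction Φ)
    (hint : IntegrableOn (fun t : ℝ => Φ t / t ^ 3) (Ioi 1)) {α : Type*} [MeasurableSpace α]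
    {μ : Measure α} {S B : ℝ} (hS : 0 < S) (hB : S < B) {T : ℝ → α → ℝ} {A : ENNReal} (hA : A ≠ ⊤)
    (hT0 : ∀ s ∈ Ioc 0 S, ∀ x, 0 ≤ T s x) (hT : ∀ s ∈ Ioc 0 S, ∀ x, T s x ≤ B / s)
    (hTA : ∀ s ∈ Ioc 0 S, ∫⁻ x, ENNReal.ofReal (T s x) ∂μ ≤ A) :
    ∫⁻ s in Ioc 0 S, ∫⁻ x, ENNReal.ofReal (Φ (T s x)) ∂μ < ⊤ := by
  have hB0 : 0 < B := hS.trans hB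
  -- The chord bound with `m = B / s` makes the slice energy linear in `T`, so only the mean of `T`
  -- matters.
  have h (s : ℝ) (hs : s ∈ Ioc 0 S) : ∫⁻ x, ENNReal.ofReal (Φ (T s x)) ∂μ ≤
      A * ENNReal.ofReal B⁻¹ * ENNReal.ofReal (s * Φ (B / s)) := by
    have hs0 : 0 < s := hs.1
    calc ∫⁻ x, ENNReal.ofReal (Φ (T s x)) ∂μ
        ≤ ∫⁻ x, ENNReal.ofReal (T s x) * ENNReal.ofReal (B⁻¹ * (s * Φ (B / s))) ∂μ := by
          refine lintegral_mono fun x => ?_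
          rw [← ENNReal.ofReal_mul (hT0 s hs x)]
          refine ENNReal.ofReal_le_ofReal
            ((hN.le_div_mul (hT0 s hs x) (hT s hs x) (by positivity)).trans_eq ?_)
          field_simp
      _ = (∫⁻ x, ENNReal.ofReal (T s x) ∂μ) * ENNReal.ofReal (B⁻¹ * (s * Φ (B / s))) :=
          lintegral_mul_const' _ _ ENNReal.ofReal_ne_top
      _ ≤ A * ENNReal.ofReal (B⁻¹ * (s * Φ (B / s))) := by
          gcongr
          exact hTA s hs
      _ = _ := by rw [ENNReal.ofReal_mul (by positivity), mul_assoc]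
  refine (setLIntegral_mono' measurableSet_Ioc h).trans_lt ?_
  have hA' : A * ENNReal.ofReal B⁻¹ ≠ ⊤ := ENNReal.mul_ne_top hA ENNReal.ofReal_ne_top
  rw [lintegral_const_mul' _ _ hA']
  exact ENNReal.mul_lt_top hA'.lt_top (hN.lintegral_mul_comp_div_lt_top hint hS hB)

end IsNFunction

/-! ### Finite energy of the extension -/

namespace IsCircleLift

variable {g k : ℝ → ℝ}

/-- The periodic function `g x - x` has the same integral after any shift, so only the constant `2c`
survives. -/
theorem integral_sub_eq (hg : IsCircleLift g) (c : ℝ) :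
    ∫ x in (-Real.pi)..Real.pi, (g (x + c) - g (x - c)) = 4 * Real.pi * c := by
  have hp : Function.Periodic (fun x => g x - x) (2 * Real.pi) := fun x => by
    simp only [hg.map_add]; ring
  have hc := hg.continuous
  have hsh (d : ℝ) : ∫ x in (-Real.pi)..Real.pi, (g (x + d) - (x + d)) =
      ∫ x in (-Real.pi)..Real.pi, (g x - x) := by
    have h := hp.intervalIntegral_add_eq (-Real.pi + d) (-Real.pi)
    rw [intervalIntegral.integral_comp_add_right (fun x => g x - x) d]
    convert! h using 2 <;> ring
  have e : (fun x => g (x + c) - g (x - c)) =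
      fun x => ((g (x + c) - (x + c)) - (g (x + -c) - (x + -c))) + 2 * c := by
    funext x
    rw [← sub_eq_add_neg]
    ring
  have i (d : ℝ) : IntervalIntegrable (fun x => g (x + d) - (x + d)) volume (-Real.pi) Real.pi :=
    Continuous.intervalIntegrable (by fun_prop) _ _
  rw [e, intervalIntegral.integral_add ((i _).sub (i _)) intervalIntegrable_const,
    intervalIntegral.integral_sub (i _) (i _), hsh, hsh, sub_self, zero_add,
    intervalIntegral.integral_const, smul_eq_mul]
  ring

theorem lintegral_ofReal_sub_eq (hg : IsCircleLift g) {c : ℝ} (hc : 0 ≤ c) :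
    ∫⁻ x in Ioc (-Real.pi) Real.pi, ENNReal.ofReal (g (x + c) - g (x - c)) =
      ENNReal.ofReal (4 * Real.pi * c) := by
  have hcont := hg.continuous
  rw [← hg.integral_sub_eq, intervalIntegral.integral_of_le (by linarith [Real.pi_pos]),
    ofReal_integral_eq_lintegral_ofReal]
  · exact Continuous.integrableOn_Ioc (μ := volume) (by fun_prop)
  · exact Eventually.of_forall fun x => sub_nonneg.2 (hg.monotone (by linarith))

/-- The mean of the increments is proportional to `y`, which cancels the denominator: `68π = 2 · 2π
+ (8 / y) · 4π · 2y`. -/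
theorem lintegral_slope_le (hg : IsCircleLift g) {y : ℝ} (hy : 0 < y) :
    ∫⁻ x in Ioc (-Real.pi) Real.pi, ENNReal.ofReal (slope g x y) ≤
      ENNReal.ofReal (68 * Real.pi) := by
  have hpi := Real.pi_pos
  have e (x : ℝ) : ENNReal.ofReal (slope g x y) = ENNReal.ofReal 2 +
      ENNReal.ofReal (8 / y) * ENNReal.ofReal (g (x + 2 * y) - g (x - 2 * y)) := by
    have h0 : 0 ≤ g (x + 2 * y) - g (x - 2 * y) := sub_nonneg.2 (hg.monotone (by linarith))
    rw [← ENNReal.ofReal_mul (by positivity), ← ENNReal.ofReal_add (by norm_num) (by positivity),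
      slope]
    congr 1
    ring
  simp only [e]
  rw [lintegral_add_left measurable_const, lintegral_const_mul' _ _ ENNReal.ofReal_ne_top,
    hg.lintegral_ofReal_sub_eq (by positivity), lintegral_const, Measure.restrict_apply_univ,
    Real.volume_Ioc, ← ENNReal.ofReal_mul (by positivity), ← ENNReal.ofReal_mul (by positivity),
    ← ENNReal.ofReal_add (by linarith) (by positivity)]
  refine ENNReal.ofReal_le_ofReal (le_of_eq ?_)
  field_simp
  ring

theorem exists_norm_fderiv_descend_le (hg : IsCircleLift g) (hk : IsCircleLift k) :
    ∃ A, 0 ≤ A ∧ ∀ z : ℂ, 0 < z.im →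
      ‖fderiv ℝ (descend (planeHomeo hg hk)) (Complex.exp (Complex.I * z))‖ ≤
        A * slope g z.re z.im := by
  obtain ⟨A, hA0, hA⟩ := norm_descend_planeHomeo_sub_le hg hk
  refine ⟨A, hA0, fun z hz => ?_⟩
  have hs := hg.two_le_slope z.re hz
  refine norm_fderiv_le_of_lip' ℝ (by positivity) ?_
  have hw : 0 < ‖Complex.exp (Complex.I * z)‖ := norm_pos_iff.2 (Complex.exp_ne_zero _)
  filter_upwards [Metric.closedBall_mem_nhds (Complex.exp (Complex.I * z))
    (show 0 < min (1 / 2) (min (z.im / 3) (2 / (3 * slope g z.re z.im))) *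
      ‖Complex.exp (Complex.I * z)‖ by positivity)] with u hu
  exact hA z u hz (mem_closedBall_iff_norm.1 hu)

/-- Pairs close relative to `‖w‖` are covered by the pointwise bound, whose slope is bounded at
heights at least `ε`; all other pairs, including `w = 0`, by the linear bound. -/
theorem exists_lipschitzOn_descend (hg : IsCircleLift g) (hk : IsCircleLift k) {r : ℝ}
    (hr : r < 1) : ∃ C, LipschitzOnWith C (descend (planeHomeo hg hk)) (Metric.closedBall 0 r) := by
  obtain ⟨A, hA0, hA⟩ := norm_descend_planeHomeo_sub_le hg hk
  obtain ⟨C, hC0, hC⟩ := hg.exists_abs_sub_le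
  obtain ⟨B, hB1, hB⟩ := (isPlaneLift hg hk).exists_norm_descend_le
  set r' := max r (1 / 2) with hr'
  have hr'1 : r' < 1 := max_lt hr (by norm_num)
  have hr'0 : 0 < r' := lt_max_of_lt_right (by norm_num)
  set ε := -Real.log r' with hε
  have hε0 : 0 < ε := neg_pos.2 (Real.log_neg hr'0 hr'1)
  set M := 34 + 16 * C / ε with hM
  have hM0 : 0 < M := by positivity
  set c := min (1 / 2) (min (ε / 3) (2 / (3 * M))) with hc
  have hc0 : 0 < c := by positivity
  set h := descend (planeHomeo hg hk) with hh
  refine ⟨(max (A * M) (B * (2 / c + 1))).toNNReal, LipschitzOnWith.of_dist_le_mul ?_⟩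
  intro u _ w hw
  rw [dist_eq_norm, dist_eq_norm, Real.coe_toNNReal _ (le_max_of_le_left (by positivity))]
  have far (hf : c * ‖w‖ ≤ ‖u - w‖) :
      ‖h u - h w‖ ≤ max (A * M) (B * (2 / c + 1)) * ‖u - w‖ := by
    have h1 : ‖w‖ ≤ ‖u - w‖ / c := (le_div_iff₀' hc0).2 hf
    have h2 : ‖u‖ ≤ ‖u - w‖ + ‖w‖ := by simpa using norm_add_le (u - w) w
    calc ‖h u - h w‖ ≤ ‖h u‖ + ‖h w‖ := norm_sub_le _ _
      _ ≤ B * ‖u‖ + B * ‖w‖ := add_le_add (hB u) (hB w)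
      _ ≤ B * (‖u - w‖ + ‖u - w‖ / c) + B * (‖u - w‖ / c) := by
          gcongr
          linarith
      _ = (B * (2 / c + 1)) * ‖u - w‖ := by ring
      _ ≤ _ := by gcongr; exact le_max_right _ _
  rcases le_total (c * ‖w‖) ‖u - w‖ with hf | hn
  · exact far hf
  by_cases hw0 : w = 0
  · exact far (by simp [hw0])
  obtain ⟨z, rfl⟩ := exists_exp_I_mul_eq hw0
  have hz : ε ≤ z.im := by
    have h1 : ‖Complex.exp (Complex.I * z)‖ ≤ r' :=
      (mem_closedBall_zero_iff.1 hw).trans (le_max_left _ _)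
    rw [norm_exp_I_mul, ← Real.le_log_iff_exp_le hr'0] at h1
    linarith
  have hz0 : 0 < z.im := hε0.trans_le hz
  have hs := hg.two_le_slope z.re hz0
  have hsM : slope g z.re z.im ≤ M := (slope_le hC z.re hz0).trans (by rw [hM]; gcongr)
  have h1 := hA z u hz0 (hn.trans (by rw [hc]; gcongr))
  calc _ ≤ A * slope g z.re z.im * ‖u - Complex.exp (Complex.I * z)‖ := h1
    _ ≤ (A * M) * ‖u - Complex.exp (Complex.I * z)‖ := by gcongr
    _ ≤ _ := by gcongr; exact le_max_left _ _

/-- Polar coordinates on the disk, with the distance to the circle as radial variable. -/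
theorem lintegral_disk_le (F : ℂ → ENNReal) :
    ∫⁻ w in disk, F w ≤ ∫⁻ s in Ioc (0 : ℝ) 1, ∫⁻ θ in Ioc (-Real.pi) Real.pi,
      F (Complex.exp (Complex.I * ⟨θ, -Real.log (1 - s)⟩)) := by
  rw [← lintegral_indicator measurableSet_ball, ← Complex.lintegral_comp_polarCoord_symm,
    polarCoord_target, Measure.volume_eq_prod, ← Measure.prod_restrict]
  refine (lintegral_prod_le _).trans ?_
  rw [← lintegral_indicator measurableSet_Ioi, ← lintegral_indicator measurableSet_Ioc,
    ← lintegral_sub_left_eq_self _ (1 : ℝ)]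
  refine lintegral_mono fun s => ?_
  by_cases hs : s ∈ Ioc (0 : ℝ) 1
  · rw [indicator_of_mem hs]
    by_cases hs1 : 1 - s ∈ Ioi (0 : ℝ)
    · rw [indicator_of_mem hs1]
      refine (lintegral_mono fun θ => ?_).trans (lintegral_mono_set Ioo_subset_Ioc_self)
      have e : Complex.polarCoord.symm (1 - s, θ) =
          Complex.exp (Complex.I * ⟨θ, -Real.log (1 - s)⟩) := by
        have : Complex.I * ⟨θ, -Real.log (1 - s)⟩ =
            (Real.log (1 - s) : ℂ) + (θ : ℂ) * Complex.I := by
          apply Complex.ext <;> simp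
        rw [this, Complex.exp_add, ← Complex.ofReal_exp, Real.exp_log hs1, Complex.exp_mul_I,
          Complex.polarCoord_symm_apply]
        simp
      -- The polar Jacobian `1 - s` is at most 1 and is discarded.
      have h1 : ENNReal.ofReal (1 - s) ≤ 1 := ENNReal.ofReal_le_one.2 (by linarith [hs.1])
      simp only [smul_eq_mul]
      rw [e]
      calc _ ≤ 1 * F _ := mul_le_mul' h1 (indicator_le_self _ _ _)
        _ = _ := one_mul _
    · rw [indicator_of_notMem hs1]
      exact zero_le
  · rw [indicator_of_notMem hs]
    by_cases hs1 : 1 - s ∈ Ioi (0 : ℝ)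
    · rw [indicator_of_mem hs1]
      have hs0 : s ≤ 0 := by
        by_contra! h0
        exact hs ⟨h0, by linarith [mem_Ioi.1 hs1]⟩
      refine (lintegral_congr fun θ => ?_).trans_le lintegral_zero.le
      rw [indicator_of_notMem, smul_zero]
      rw [mem_ball_zero_iff, Complex.norm_polarCoord_symm, not_lt]
      exact le_abs.2 (Or.inl (by simp only; linarith))
    · rw [indicator_of_notMem hs1]

theorem hasFiniteEnergy_descend {Φ : ℝ → ℝ} (hN : IsNFunction Φ)
    (hint : IntegrableOn (fun t : ℝ => Φ t / t ^ 3) (Ioi 1)) (hg : IsCircleLift g)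
    (hk : IsCircleLift k) : HasFiniteEnergy Φ (descend (planeHomeo hg hk)) where
  lipschitzOn _ hr := exists_lipschitzOn_descend hg hk hr
  bounded := ⟨1, fun w hw => (isPlaneLift hg hk).norm_descend_le_one
    (fun _ => planeHomeo_im_nonneg hg hk) (mem_ball_zero_iff.1 hw).le⟩
  lintegral_lt_top := by
    obtain ⟨A, hA0, hA⟩ := exists_norm_fderiv_descend_le hg hk
    obtain ⟨C, hC0, hC⟩ := hg.exists_abs_sub_le
    refine (lintegral_disk_le _).trans_lt ?_
    have hlog {s : ℝ} (hs : s ∈ Ioo (0 : ℝ) 1) : s ≤ -Real.log (1 - s) := by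
      linarith [Real.log_le_sub_one_of_pos (sub_pos.2 hs.2)]
    -- At `s = 1` the default `log 0 = 0` gives height 0, where the slope bounds do not apply; this
    -- null slice is set to 0.
    set T : ℝ → ℝ → ℝ := fun s θ => if s < 1 then A * slope g θ (-Real.log (1 - s)) else 0 with hT
    -- Since the height is at least `s` and `s ≤ 1`, the slope is at most `(34 + 16 C) / s`; the
    -- summand 2 only secures `S < B`.
    have h := hN.lintegral_lintegral_lt_top hint (μ := volume.restrict (Ioc (-Real.pi) Real.pi))
      (S := 1) (B := A * (34 + 16 * C) + 2) (T := T)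
      (A := ENNReal.ofReal A * ENNReal.ofReal (68 * Real.pi)) one_pos
      (by nlinarith [mul_nonneg hA0 hC0]) 
      (ENNReal.mul_ne_top ENNReal.ofReal_ne_top ENNReal.ofReal_ne_top) ?_ ?_ ?_
    · refine lt_of_le_of_lt (setLIntegral_mono_ae' measurableSet_Ioc ?_) h
      filter_upwards [Measure.ae_ne volume (1 : ℝ)] with s hs1 hs
      have hs' : s ∈ Ioo (0 : ℝ) 1 := ⟨hs.1, lt_of_le_of_ne hs.2 hs1⟩
      refine lintegral_mono fun θ => ENNReal.ofReal_le_ofReal ?_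
      have h0 := hA ⟨θ, -Real.log (1 - s)⟩ (hs.1.trans_le (hlog hs'))
      simp only [hT, if_pos hs'.2]
      exact hN.monotoneOn (norm_nonneg _) ((norm_nonneg _).trans h0) h0
    · intro s hs θ
      simp only [hT]
      split_ifs with h1
      · have := hg.two_le_slope θ (hs.1.trans_le (hlog ⟨hs.1, h1⟩))
        positivity
      · exact le_rfl
    · intro s hs θ
      have hs0 : 0 < s := hs.1
      simp only [hT]
      split_ifs with h1
      · have hl := hlog ⟨hs.1, h1⟩
        calc A * slope g θ (-Real.log (1 - s)) ≤ A * (34 + 16 * C / -Real.log (1 - s)) := by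
              gcongr
              exact slope_le hC θ (hs0.trans_le hl)
          _ ≤ A * (34 / s + 16 * C / s) := by
              gcongr
              exact (le_div_iff₀ hs0).2 (by nlinarith [hs.2])
          _ = A * (34 + 16 * C) / s := by ring
          _ ≤ _ := by gcongr; linarith
      · positivity
    · intro s hs
      simp only [hT]
      split_ifs with h1
      · simp only [ENNReal.ofReal_mul hA0]
        rw [lintegral_const_mul' _ _ ENNReal.ofReal_ne_top]
        gcongr
        exact hg.lintegral_slope_le (hs.1.trans_le (hlog ⟨hs.1, h1⟩))
      · simp

theorem memOrliczSobolev_extension {Φ : ℝ → ℝ} (hN : IsNFunction Φ)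
    (hint : IntegrableOn (fun t : ℝ => Φ t / t ^ 3) (Ioi 1)) (hg : IsCircleLift g)
    (hk : IsCircleLift k) : MemOrliczSobolev Φ disk (toPlane (extension hg hk)) := by
  refine memOrliczSobolev_congr measurableSet_ball (fun z hz => ?_)
    ((hasFiniteEnergy_descend hN hint hg hk).memOrliczSobolev hN)
  exact (toPlane_apply (extension hg hk) ⟨z, Metric.ball_subset_closedBall hz⟩).symm

end IsCircleLift

/-! ### Lifting circle homeomorphisms to the line -/

/-- The point of the unit circle with angle `θ`. -/
noncomputable def circlePoint (θ : ℝ) : circle :=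
  ⟨circleMap 0 1 θ, circleMap_mem_sphere 0 zero_le_one θ⟩

theorem coe_circlePoint (θ : ℝ) : (circlePoint θ : ℂ) = Complex.exp (Complex.I * θ) := by
  simp [circlePoint, circleMap, mul_comm]

theorem continuous_circlePoint : Continuous circlePoint :=
  (continuous_circleMap 0 1).subtype_mk _

theorem circlePoint_surjective : Function.Surjective circlePoint := fun ξ => by
  obtain ⟨z, hz⟩ := exists_exp_I_mul_eq (w := (ξ : ℂ)) (by
    rw [← norm_pos_iff, mem_sphere_zero_iff_norm.1 ξ.2]; exact one_pos)
  have h1 : ‖Complex.exp (Complex.I * z)‖ = 1 := by rw [hz]; exact mem_sphere_zero_iff_norm.1 ξ.2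
  rw [norm_exp_I_mul, Real.exp_eq_one_iff, neg_eq_zero] at h1
  refine ⟨z.re, Subtype.ext ?_⟩
  rw [coe_circlePoint, ← hz]
  congr 2
  apply Complex.ext <;> simp [h1]

theorem exp_I_mul_ofReal_eq_iff {x y : ℝ} :
    Complex.exp (Complex.I * x) = Complex.exp (Complex.I * y) ↔
      ∃ n : ℤ, x = y + n * (2 * Real.pi) := by
  rw [Complex.exp_eq_exp_iff_exists_int]
  refine exists_congr fun n => ?_
  have e : Complex.I * y + n * (2 * Real.pi * Complex.I) =
      Complex.I * ((y + n * (2 * Real.pi) : ℝ) : ℂ) := by push_cast; ring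
  rw [e, mul_right_inj' Complex.I_ne_zero, Complex.ofReal_inj]

theorem circlePoint_add_two_pi (x : ℝ) : circlePoint (x + 2 * Real.pi) = circlePoint x :=
  Subtype.ext (by
    rw [coe_circlePoint, coe_circlePoint, exp_I_mul_ofReal_eq_iff]
    exact ⟨1, by simp⟩)

/-- `g` is a lift to the real line of the self-map `φ` of the circle. -/
def IsLiftOf (g : ℝ → ℝ) (φ : circle → circle) : Prop :=
  ∀ x : ℝ, φ (circlePoint x) = circlePoint (g x)

/-- The loop lifts through the covering `exp`; its unit modulus forces the lift to be purely
imaginary. -/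
theorem exists_isLiftOf {φ : circle → circle} (hφ : Continuous φ) :
    ∃ g : ℝ → ℝ, Continuous g ∧ IsLiftOf g φ := by
  let f : C(ℝ, ℂ) := ⟨fun x => (φ (circlePoint x) : ℂ),
    continuous_subtype_val.comp (hφ.comp continuous_circlePoint)⟩
  have hn (x : ℝ) : ‖f x‖ = 1 := mem_sphere_zero_iff_norm.1 (φ (circlePoint x)).2
  have h0 (x : ℝ) : f x ≠ 0 := by
    rw [← norm_pos_iff, hn]
    exact one_pos
  obtain ⟨F, ⟨-, hF⟩, -⟩ := Complex.isCoveringMapOn_exp.existsUnique_continuousMap_lifts f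
    (a₀ := 0) (e₀ := Complex.log (f 0)) (Complex.exp_log (h0 0)) (fun x => h0 x)
  refine ⟨fun x => (F x).im, Complex.continuous_im.comp F.continuous, fun x => Subtype.ext ?_⟩
  have hx : Complex.exp (F x) = φ (circlePoint x) := congr_fun hF x
  have hre : (F x).re = 0 := by
    have h := hn x
    change ‖(φ (circlePoint x) : ℂ)‖ = 1 at h
    rwa [← hx, Complex.norm_exp, Real.exp_eq_one_iff] at h
  rw [coe_circlePoint, ← hx]
  congr 1
  apply Complex.ext <;> simp [hre]

theorem exists_int_of_forall_exists {f : ℝ → ℝ} (hf : Continuous f)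
    (h : ∀ x, ∃ n : ℤ, f x = n * (2 * Real.pi)) : ∃ n : ℤ, ∀ x, f x = n * (2 * Real.pi) := by
  choose n hn using h
  have hc : Continuous n := by
    rw [Int.isClosedEmbedding_coe_real.isInducing.continuous_iff]
    have : (fun m : ℤ => (m : ℝ)) ∘ n = fun x => f x / (2 * Real.pi) := by
      funext x
      rw [Function.comp_apply, hn x, mul_div_cancel_right₀ _ Real.two_pi_pos.ne']
    rw [this]
    exact hf.div_const _
  refine ⟨n 0, fun x => ?_⟩
  rw [hn x, PreconnectedSpace.constant inferInstance hc (x := x) (y := 0)]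

theorem circlePoint_eq_iff {x y : ℝ} :
    circlePoint x = circlePoint y ↔ ∃ n : ℤ, x = y + n * (2 * Real.pi) := by
  rw [← exp_I_mul_ofReal_eq_iff, ← coe_circlePoint, ← coe_circlePoint, Subtype.ext_iff]

theorem IsLiftOf.exists_comp_eq {φ : circle ≃ₜ circle} {g k : ℝ → ℝ} (hgc : Continuous g)
    (hg : IsLiftOf g φ) (hkc : Continuous k) (hk : IsLiftOf k φ.symm) :
    ∃ n : ℤ, ∀ x, g (k x) = x + n * (2 * Real.pi) := by
  obtain ⟨n, hn⟩ := exists_int_of_forall_exists (f := fun x => g (k x) - x) (by fun_prop) fun x => by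
    have : circlePoint (g (k x)) = circlePoint x := by
      rw [← hg, ← hk, Homeomorph.apply_symm_apply]
    obtain ⟨n, hn⟩ := circlePoint_eq_iff.1 this
    exact ⟨n, by linarith⟩
  exact ⟨n, fun x => by linarith [hn x]⟩

/-- Circle homeomorphisms have invertible lifts, of degree one or minus one. -/
theorem exists_lift_of_homeomorph (φ : circle ≃ₜ circle) :
    ∃ (g k : ℝ → ℝ), Continuous k ∧ Function.LeftInverse k g ∧ Function.RightInverse k g ∧
      IsLiftOf g φ ∧ (IsCircleLift g ∨ IsCircleLift (fun x => -g x)) := by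
  obtain ⟨g, hgc, hg⟩ := exists_isLiftOf φ.continuous
  obtain ⟨k, hkc, hk⟩ := exists_isLiftOf φ.symm.continuous
  obtain ⟨a, ha⟩ := hg.exists_comp_eq hgc hkc hk
  obtain ⟨b, hb⟩ := IsLiftOf.exists_comp_eq (φ := φ.symm) hkc hk hgc hg
  have hinj : Function.Injective g := fun x y hxy => by
    have h1 := hb x
    rw [hxy, hb y] at h1
    linarith
  -- The lifts of `φ` and of its inverse compose to a translation by `2πa`, which is absorbed into
  -- `k`.
  have hright : Function.RightInverse (fun x => k (x - a * (2 * Real.pi))) g := fun x => by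
    change g (k (x - a * (2 * Real.pi))) = x
    rw [ha]
    ring
  obtain ⟨d, hd⟩ := exists_int_of_forall_exists (f := fun x => g (x + 2 * Real.pi) - g x)
    (by fun_prop) fun x => by
      have : circlePoint (g (x + 2 * Real.pi)) = circlePoint (g x) := by
        rw [← hg, ← hg, circlePoint_add_two_pi]
      obtain ⟨n, hn⟩ := circlePoint_eq_iff.1 this
      exact ⟨n, by linarith⟩
  -- A point `y` with `g y = g 0 + 2π` lies over the same circle point as 0, so `y = 2πn`, and `n d
  -- = 1` in the integers.
  have hdeg : d = 1 ∨ d = -1 := by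
    obtain ⟨y, hy⟩ : ∃ y, g y = g 0 + 2 * Real.pi := ⟨_, hright _⟩
    have h1 : circlePoint y = circlePoint 0 := by
      apply φ.injective
      rw [hg, hg, hy, circlePoint_add_two_pi]
    obtain ⟨n, hn⟩ := circlePoint_eq_iff.1 h1
    have hp : Function.Periodic (fun x => g x - d * x) (2 * Real.pi) := fun x => by
      have := hd x
      simp only
      linarith
    have h2 : g (0 + n * (2 * Real.pi)) - d * (0 + n * (2 * Real.pi)) = g 0 - d * 0 :=
      hp.int_mul n 0
    rw [← hn, hy, hn] at h2
    have h3 : (2 * Real.pi) * ((n : ℝ) * d) = (2 * Real.pi) * 1 := by linear_combination -h2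
    have h4 : n * d = 1 := by
      have := mul_left_cancel₀ Real.two_pi_pos.ne' h3
      exact_mod_cast this
    exact Int.isUnit_iff.1 (IsUnit.of_mul_eq_one_right n h4)
  refine ⟨g, fun x => k (x - a * (2 * Real.pi)), by fun_prop, hright.leftInverse_of_injective hinj,
    hright, hg, ?_⟩
  have h0 := hd 0
  rcases hgc.strictMono_of_inj hinj with hm | hm
  · left
    refine ⟨hgc, hm.monotone, fun x => ?_⟩
    rcases hdeg with rfl | rfl
    · have := hd x
      push_cast at this
      linarith
    · have := hm (show (0 : ℝ) < 0 + 2 * Real.pi by linarith [Real.two_pi_pos])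
      push_cast at h0
      linarith [Real.two_pi_pos]
  · right
    refine ⟨hgc.neg, hm.antitone.neg, fun x => ?_⟩
    rcases hdeg with rfl | rfl
    · have := hm (show (0 : ℝ) < 0 + 2 * Real.pi by linarith [Real.two_pi_pos])
      push_cast at h0
      linarith [Real.two_pi_pos]
    · have := hd x
      push_cast at this
      linarith

/-! ### The boundary values and the Douglas condition -/

namespace IsCircleLift

variable {g k : ℝ → ℝ}

theorem of_inverse (hg : IsCircleLift g) (hk : Continuous k) (hl : Function.LeftInverse k g)
    (hr : Function.RightInverse k g) : IsCircleLift k where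
  continuous := hk
  monotone x y hxy := by
    by_contra! h
    have := hg.monotone h.le
    rw [hr, hr] at this
    exact h.ne (by rw [le_antisymm hxy this])
  map_add x := by
    apply hl.injective
    rw [hr, hg.map_add, hr]

theorem isExtension_extension (hg : IsCircleLift g) (hk : IsCircleLift k)
    (hl : Function.LeftInverse k g) {φ : circle → circle} (hφ : IsLiftOf g φ) (ξ : circle) :
    (extension hg hk (inclusion Metric.sphere_subset_closedBall ξ) : ℂ) = φ ξ := by
  obtain ⟨x, rfl⟩ := circlePoint_surjective ξ
  rw [hφ, extension_apply]
  change descend _ (circlePoint x : ℂ) = _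
  rw [coe_circlePoint, coe_circlePoint, (isPlaneLift hg hk).descend_exp,
    planeHomeo_ofReal hg hk hl]

/-- A chord has length `2 |sin (α/2)|`: bounded by the angle in the numerator, and below by `2 |s| /
π` (Jordan's inequality) in the denominator. -/
theorem norm_div_le (hg : IsCircleLift g) (x : ℝ) {s : ℝ} (hs : |s| ≤ Real.pi) :
    ‖((circlePoint (g x) : ℂ) - circlePoint (g (x + s))) /
      ((circlePoint x : ℂ) - circlePoint (x + s))‖ ≤
      Real.pi / 2 * ((g (x + |s|) - g (x - |s|)) / |s|) := by
  rcases eq_or_ne s 0 with rfl | hs0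
  · simp
  have hs0' : 0 < |s| := abs_pos.2 hs0
  have e (a b : ℝ) : ‖(circlePoint a : ℂ) - circlePoint b‖ = 2 * |Real.sin ((b - a) / 2)| := by
    rw [coe_circlePoint, coe_circlePoint, norm_sub_rev]
    have : Complex.exp (Complex.I * b) - Complex.exp (Complex.I * a) =
        Complex.exp (Complex.I * a) * (Complex.exp (Complex.I * ((b - a : ℝ) : ℂ)) - 1) := by
      rw [mul_sub, mul_one, ← Complex.exp_add]
      congr 2
      push_cast
      ring
    rw [this, norm_mul, norm_exp_I_mul, Complex.norm_exp_I_mul_ofReal_sub_one]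
    simp
  have hnum : ‖(circlePoint (g x) : ℂ) - circlePoint (g (x + s))‖ ≤ g (x + |s|) - g (x - |s|) := by
    rw [e]
    have h1 : |Real.sin ((g (x + s) - g x) / 2)| ≤ |(g (x + s) - g x) / 2| := Real.abs_sin_le_abs
    rw [abs_div, abs_two] at h1
    have h2 : |g (x + s) - g x| ≤ g (x + |s|) - g (x - |s|) := by
      have m1 := hg.monotone (show x + s ≤ x + |s| by linarith [le_abs_self s])
      have m2 := hg.monotone (show x - |s| ≤ x + s by linarith [neg_abs_le s])
      have m3 := hg.monotone (show x - |s| ≤ x by linarith)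
      have m4 := hg.monotone (show x ≤ x + |s| by linarith)
      exact abs_le.2 ⟨by linarith, by linarith⟩
    linarith
  have hden : 2 / Real.pi * |s| ≤ ‖(circlePoint x : ℂ) - circlePoint (x + s)‖ := by
    rw [e, add_sub_cancel_left]
    have h1 : |s / 2| ≤ Real.pi / 2 := by rw [abs_div, abs_two]; linarith
    have h2 := Real.mul_abs_le_abs_sin h1
    rw [abs_div, abs_two] at h2
    linarith
  have hpi := Real.pi_pos
  have hnum0 := (norm_nonneg _).trans hnum
  rw [norm_div]
  calc _ ≤ (g (x + |s|) - g (x - |s|)) / (2 / Real.pi * |s|) := by gcongr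
    _ = _ := by field_simp

theorem lintegral_period_eq {f : ℝ → ENNReal} (hf : Function.Periodic f (2 * Real.pi)) (x : ℝ) :
    ∫⁻ y in Ioc (-Real.pi) Real.pi, f y = ∫⁻ s in Ioc (-Real.pi) Real.pi, f (x + s) := by
  have h := (isAddFundamentalDomain_Ioc Real.two_pi_pos (-Real.pi)).setLIntegral_eq
    (isAddFundamentalDomain_Ioc Real.two_pi_pos (x + -Real.pi)) f (by
      rintro ⟨t, n, rfl⟩ y
      have := hf.int_mul n y
      change f (n • (2 * Real.pi) + y) = f y
      rwa [zsmul_eq_mul, add_comm])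
  have e1 : -Real.pi + 2 * Real.pi = Real.pi := by ring
  have e2 : x + -Real.pi + 2 * Real.pi = x + Real.pi := by ring
  rw [e1, e2] at h
  rw [h, ← lintegral_indicator measurableSet_Ioc, ← lintegral_indicator measurableSet_Ioc,
    ← lintegral_add_left_eq_self _ x]
  refine lintegral_congr fun s => ?_
  simp only [indicator, mem_Ioc, add_lt_add_iff_left, add_le_add_iff_left]

theorem douglas {Φ : ℝ → ℝ} (hN : IsNFunction Φ)
    (hint : IntegrableOn (fun t : ℝ => Φ t / t ^ 3) (Ioi 1)) (hg : IsCircleLift g)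
    {φ : circle → circle} (hφ : IsLiftOf g φ) : Douglas Φ (fun ξ => (φ ξ : ℂ)) := by
  have hpi := Real.pi_pos
  obtain ⟨C, hC0, hC⟩ := hg.exists_abs_sub_le
  set μ := volume.restrict (Ioc (-Real.pi) Real.pi) with hμ
  set T : ℝ → ℝ → ℝ := fun s x => Real.pi / 2 * ((g (x + s) - g (x - s)) / s) with hT
  have hT0 {s : ℝ} (hs : 0 ≤ s) (x : ℝ) : 0 ≤ T s x := by
    have := hg.monotone (show x - s ≤ x + s by linarith)
    exact mul_nonneg (by positivity) (div_nonneg (by linarith) hs)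
  set K : circle → circle → ENNReal := fun ξ η =>
    ENNReal.ofReal (Φ ‖((φ ξ : ℂ) - φ η) / ((ξ : ℂ) - η)‖) with hK
  have hpt (x s : ℝ) (hs : s ∈ Ioc (-Real.pi) Real.pi) :
      K (circlePoint x) (circlePoint (x + s)) ≤ ENNReal.ofReal (Φ (max (T |s| x) 0)) := by
    refine ENNReal.ofReal_le_ofReal (hN.monotoneOn (norm_nonneg _) (mem_Ici.2 (le_max_right _ _)) ?_)
    rw [hφ, hφ]
    exact (hg.norm_div_le x (abs_le.2 ⟨hs.1.le, hs.2⟩)).trans (le_max_left _ _)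
  -- `Φ` is continuous only on `[0, ∞)`; the truncation makes the majorant Borel, as exchanging the
  -- integrals requires.
  have hΦ : Measurable fun t => Φ (max t 0) :=
    (hN.continuousOn.comp_continuous (by fun_prop) fun t => le_max_right t 0).measurable
  have hgm := hg.continuous.measurable
  have hmeas : Measurable (Function.uncurry fun x s => ENNReal.ofReal (Φ (max (T |s| x) 0))) := by
    refine (hΦ.comp (g := fun t => Φ (max t 0)) (f := fun p : ℝ × ℝ => T |p.2| p.1) ?_).ennreal_ofReal
    have habs : Measurable fun p : ℝ × ℝ => |p.2| := by fun_prop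
    exact (((hgm.comp (measurable_fst.add habs)).sub
      (hgm.comp (measurable_fst.sub habs))).div habs).const_mul _
  have hkey : ∫⁻ s in Ioc 0 Real.pi, ∫⁻ x, ENNReal.ofReal (Φ (T s x)) ∂μ < ⊤ := by
    -- For `s ≤ π` the increment of `g` is at most `2π + 2C`, while `π + 1` secures `S < B`; the
    -- slice integral is `(π / (2s)) · 4πs = 2π²`.
    refine hN.lintegral_lintegral_lt_top hint (S := Real.pi)
      (B := Real.pi / 2 * (2 * Real.pi + 2 * C) + (Real.pi + 1)) (T := T)
      (A := ENNReal.ofReal (2 * Real.pi ^ 2)) hpi ?_ ENNReal.ofReal_ne_top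
      (fun s hs => hT0 hs.1.le) ?_ ?_
    · have : 0 ≤ Real.pi / 2 * (2 * Real.pi + 2 * C) := by positivity
      linarith
    · intro s hs x
      have h := sub_le_of_abs_sub_le hC x (s / 2)
      have e : 2 * (s / 2) = s := by ring
      rw [e] at h
      have hs0 : 0 < s := hs.1
      calc T s x ≤ Real.pi / 2 * ((2 * Real.pi + 2 * C) / s) := by
            simp only [hT]
            gcongr
            linarith [hs.2]
        _ = Real.pi / 2 * (2 * Real.pi + 2 * C) / s := by ring
        _ ≤ _ := by gcongr; linarith
    · intro s hs
      have hs0 : 0 < s := hs.1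
      have e (x : ℝ) : ENNReal.ofReal (T s x) =
          ENNReal.ofReal (Real.pi / 2 / s) * ENNReal.ofReal (g (x + s) - g (x - s)) := by
        rw [← ENNReal.ofReal_mul (by positivity)]
        congr 1
        simp only [hT]
        ring
      simp only [e]
      rw [lintegral_const_mul' _ _ ENNReal.ofReal_ne_top, hg.lintegral_ofReal_sub_eq hs0.le,
        ← ENNReal.ofReal_mul (by positivity)]
      refine ENNReal.ofReal_le_ofReal (le_of_eq ?_)
      field_simp
      norm_num
  have hkey' : ∫⁻ s in Ioc 0 Real.pi, ∫⁻ x, ENNReal.ofReal (Φ (max (T |s| x) 0)) ∂μ < ⊤ := by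
    refine lt_of_eq_of_lt (setLIntegral_congr_fun measurableSet_Ioc fun s hs => ?_) hkey
    simp only [abs_of_pos hs.1, max_eq_left (hT0 hs.1.le _)]
  have hneg : ∫⁻ s in Ico (-Real.pi) 0, ∫⁻ x, ENNReal.ofReal (Φ (max (T |s| x) 0)) ∂μ < ⊤ := by
    refine lt_of_eq_of_lt ?_ hkey'
    rw [← lintegral_indicator measurableSet_Ico, ← lintegral_indicator measurableSet_Ioc,
      ← lintegral_neg_eq_self]
    refine lintegral_congr fun s => ?_
    simp only [indicator, mem_Ico, mem_Ioc, neg_le_neg_iff, neg_lt_zero, abs_neg, and_comm]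
  have hsub : Ioc (-Real.pi) Real.pi ⊆ (Ico (-Real.pi) 0 ∪ Ioc 0 Real.pi) ∪ {0} := by
    intro s hs
    rcases lt_trichotomy s 0 with h | h | h
    · exact Or.inl (Or.inl ⟨hs.1.le, h⟩)
    · exact Or.inr h
    · exact Or.inl (Or.inr ⟨h, hs.2⟩)
  have hall : ∫⁻ s, ∫⁻ x, ENNReal.ofReal (Φ (max (T |s| x) 0)) ∂μ ∂μ < ⊤ := by
    refine (lintegral_mono_set hsub).trans_lt ?_
    refine (lintegral_union_le _ _ _).trans_lt (ENNReal.add_lt_top.2 ⟨?_, by simp⟩)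
    exact (lintegral_union_le _ _ _).trans_lt (ENNReal.add_lt_top.2 ⟨hneg, hkey'⟩)
  rw [← lintegral_lintegral_swap hmeas.aemeasurable] at hall
  refine lt_of_le_of_lt ?_ hall
  -- For fixed `x` periodicity recentres the inner integral at `x`, so that `s` becomes the angular
  -- distance up to sign.
  refine (lintegral_map_le _ _).trans (lintegral_mono fun x => ?_)
  refine (lintegral_map_le _ _).trans ?_
  change ∫⁻ y in Ioc (-Real.pi) Real.pi, K (circlePoint x) (circlePoint y) ≤ _
  rw [lintegral_period_eq (f := fun y => K (circlePoint x) (circlePoint y))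
    (fun y => by simp only [circlePoint_add_two_pi]) x]
  exact setLIntegral_mono' measurableSet_Ioc (hpt x)

end IsCircleLift

/-! ### Conjugation and the orientation-reversing case -/

/-- Complex conjugation on the circle. -/
noncomputable def conjCircle : circle ≃ₜ circle :=
  Complex.conjLIE.toHomeomorph.subtype fun z => by simp

/-- Complex conjugation on the closed disk. -/
noncomputable def conjDisk : closedDisk ≃ₜ closedDisk :=
  Complex.conjLIE.toHomeomorph.subtype fun z => by simp

theorem coe_conjCircle (ξ : circle) : (conjCircle ξ : ℂ) = starRingEnd ℂ ξ := rfl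

theorem coe_conjDisk (z : closedDisk) : (conjDisk z : ℂ) = starRingEnd ℂ z := rfl

theorem conjCircle_circlePoint (x : ℝ) : conjCircle (circlePoint x) = circlePoint (-x) :=
  Subtype.ext (by
    rw [coe_conjCircle, coe_circlePoint, coe_circlePoint, ← Complex.exp_conj]
    simp)

end OrliczDisk

theorem corollary1p3 (Φ : ℝ → ℝ) (hN : OrliczDisk.IsNFunction Φ)
    (hdoubling : OrliczDisk.IsDoubling Φ)
    (hint : IntegrableOn (fun t : ℝ => Φ t / t ^ 3) (Ioi 1) volume)
    (φ : OrliczDisk.circle ≃ₜ OrliczDisk.circle) :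
    OrliczDisk.Douglas Φ (fun ξ => (φ ξ : ℂ)) ∧
    ∃ h : OrliczDisk.closedDisk ≃ₜ OrliczDisk.closedDisk,
      OrliczDisk.IsExtension φ h ∧
      OrliczDisk.MemOrliczSobolev Φ OrliczDisk.disk (OrliczDisk.toPlane h) ∧
      OrliczDisk.MemOrliczSobolev Φ OrliczDisk.disk (OrliczDisk.toPlane h.symm) := by
  open OrliczDisk OrliczDisk.IsCircleLift in
  obtain ⟨g, k, hkc, hl, hr, hφ, hg | hg⟩ := exists_lift_of_homeomorph φ
  · have hk := hg.of_inverse hkc hl hr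
    exact ⟨hg.douglas hN hint hφ, extension hg hk, isExtension_extension hg hk hl hφ,
      memOrliczSobolev_extension hN hint hg hk, memOrliczSobolev_extension hN hint hk hg⟩
  -- When `g` is decreasing, the conjugate of `φ` has increasing lift `-g`, with inverse `x ↦ k
  -- (-x)`. Conjugating the extension back preserves all the integrals, as conjugation is an
  -- isometry.
  · have hl' : Function.LeftInverse (fun x => k (-x)) (fun x => -g x) := fun x => by
      simp only [neg_neg, hl x]
    have hr' : Function.RightInverse (fun x => k (-x)) (fun x => -g x) := fun x => by
      change -g (k (-x)) = x
      rw [hr, neg_neg]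
    have hk := hg.of_inverse (by fun_prop : Continuous fun x => k (-x)) hl' hr'
    have hφ' : IsLiftOf (fun x => -g x) (φ.trans conjCircle) := fun x => by
      rw [Homeomorph.trans_apply, hφ, conjCircle_circlePoint]
    refine ⟨?_, (extension hg hk).trans conjDisk, fun ξ => ?_, ?_, ?_⟩
    · have h := hg.douglas hN hint hφ'
      have e (ξ η : OrliczDisk.circle) : ‖(((φ.trans conjCircle) ξ : ℂ) - (φ.trans conjCircle) η) /
          ((ξ : ℂ) - η)‖ = ‖((φ ξ : ℂ) - φ η) / ((ξ : ℂ) - η)‖ := by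
        rw [Homeomorph.trans_apply, Homeomorph.trans_apply, coe_conjCircle, coe_conjCircle,
          ← map_sub, norm_div, norm_div, Complex.norm_conj]
      simp only [Douglas, e] at h
      exact h
    · rw [Homeomorph.trans_apply, coe_conjDisk, isExtension_extension hg hk hl' hφ',
        Homeomorph.trans_apply, coe_conjCircle, Complex.conj_conj]
    · refine memOrliczSobolev_congr measurableSet_ball (fun z hz => ?_)
        ((hasFiniteEnergy_descend hN hint hg hk).conj_comp.memOrliczSobolev hN)
      exact (toPlane_apply ((extension hg hk).trans conjDisk)
        ⟨z, Metric.ball_subset_closedBall hz⟩).symm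
    · refine memOrliczSobolev_congr measurableSet_ball (fun z hz => ?_)
        ((hasFiniteEnergy_descend hN hint hk hg).comp_conj.memOrliczSobolev hN)
      exact (toPlane_apply ((extension hg hk).trans conjDisk).symm
        ⟨z, Metric.ball_subset_closedBall hz⟩).symm
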